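/- Let $M$ be a smooth manifold of dimension $n\ge 2$ with a projective structure $\boldsymbol p$, i.e. an equivalence class of smooth torsion-free affine connections, where $\nabla\sim\widehat\nabla$ if $\widehat\nabla_a\xi^b=\nabla_a\xi^b+\Upsilon_a\xi^b+\delta^b{}_a\Upsilon_c\xi^c$ for a smooth 1-form $\Upsilon$ (for an affine manifold $(M,\nabla)$ take $\boldsymbol p=[\nabla]$). Let $\mathcal E(w)=\big((\Lambda^nTM)^{2}\big)^{w/(2n+2)}$ be the oriented density line bundles, let $\mathcal T^*=J^1\mathcal E(1)$ be the cotractor bundle and $\mathcal T$ its dual, and let the canonical tractor $X\in\Gamma(\mathcal T(1))$, $\mathcal T(1)=\mathcal T\otimes\mathcal E(1)$, be the jet projection $J^1\mathcal E(1)\to\mathcal E(1)$. A connection $\nabla\in\boldsymbol p$ identifies $j^1\sigma$ with the pair $(\sigma,\mu_b)=(\sigma,\nabla_b\sigma)$, and the tractor connection is the dual of $$\nabla_a(\sigma,\mu_b)=(\nabla_a\sigma-\mu_a,\ \nabla_a\mu_b+P_{ab}\sigma),$$ extended to $\Lambda^2\mathcal T$ by the Leibniz rule. Here $P_{ab}$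 is the projective Schouten tensor: $(n-1)P_{ab}=R_{ab}+\beta_{ab}$, $\beta_{ab}=P_{ba}-P_{ab}$, where $R_{bd}=R_{cb}{}^c{}_d$ is the Ricci tensor of $\nabla$. Let $\gamma$ be an unparametrised oriented curve in $M$, given by a smooth immersion $\gamma:J\to M$ of a nonempty open interval $J$, up to orientation-preserving reparametrisation. (Every non-closed connected embedded oriented curve is of this form; a closed curve is to be represented by a periodic immersion $\mathbb R\to M$.) Fields along $\gamma$ are fields over $J$. The curve $\gamma$ is an unparametrised geodesic of $\nabla$ if it has a smooth velocity field $u=f\gamma'$, $f>0$, with $\nabla_uu=0$, and an unparametrised geodesic of $\boldsymbol p$ if it is one of some $\nabla\in\boldsymbol p$. Then: 1. For every $\nabla\in\boldsymbol p$, $\gamma$ is an unparametrised geodesic of $\boldsymbol p$ if and only if it is one of $\nabla$, and if and only if along $\gamma$ there is a smooth 2-tractor $0\ne\Sigma\in\Gamma(\Lambda^2\mathcal T|_\gamma)$ that is parallel along $\gamma$ for the tractor connection and satisfies $X\wedge\Sigma=0$. 2. If $\gamma$ is an unparametrised geodesic, then such a $\Sigma$ is unique up to multiplication by a nonzero constant;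 and among them there is one that is compatible with the orientation of $\gamma$, and it is unique up to multiplication by a positive constant. Here $\Sigma$ is compatible with the orientation if at each point there is a positive $\rho\in\mathcal E(-2)$ such that, for all cotractors $\alpha=(\sigma,\mu)$ and $\alpha'=(\sigma',\mu')$, $\ \Sigma(\alpha,\alpha')=\rho\,\big(\sigma\,\mu'(\gamma')-\sigma'\,\mu(\gamma')\big)$. -/

import Mathlib

open Set Bundle Module
open scoped Manifold ContDiff Topology

noncomputable section

namespace ProjectiveTractor

section Algebra

/-- The fibre of the density bundle `𝓔(w) = 𝓚 ^ (w / (2n+2))`, `𝓚 = (Λⁿ TM)²`, over a point with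
tangent space `V` of dimension `n`.  If `s = c(b) (b₁ ∧ ⋯ ∧ bₙ)²` is an element of `(Λⁿ V)²`, then
`c(f ∘ b) = (det f)⁻² c(b)`; hence an element of the oriented root `𝓔(w)` is a function `φ` of
frames `b` of `V` with `φ (f ∘ b) = |det f| ^ (-w/(n+1)) φ b` for invertible `f`.  It is extended
by zero to the families that are not frames. -/
def densitySubmodule (w : ℝ) (n : ℕ) (V : Type*) [AddCommGroup V] [Module ℝ V] :
    Submodule ℝ ((Fin n → V) → ℝ) where
  carrier := {φ | (∀ b, ¬ LinearIndependent ℝ b → φ b = 0) ∧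
    ∀ (f : V →ₗ[ℝ] V) (b : Fin n → V), LinearIndependent ℝ b → LinearMap.det f ≠ 0 →
      φ (f ∘ b) = |LinearMap.det f| ^ (-w / ((n : ℝ) + 1)) * φ b}
  add_mem' := by
    rintro φ ψ ⟨h1, h2⟩ ⟨k1, k2⟩
    refine ⟨fun b hb => by simp [h1 b hb, k1 b hb], fun f b hb hf => ?_⟩
    simp only [Pi.add_apply, h2 f b hb hf, k2 f b hb hf]
    ring
  zero_mem' := ⟨fun _ _ => rfl, fun _ _ _ _ => by simp⟩
  smul_mem' := by
    rintro c φ ⟨h1, h2⟩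
    refine ⟨fun b hb => by simp [h1 b hb], fun f b hb hf => ?_⟩
    simp only [Pi.smul_apply, h2 f b hb hf, smul_eq_mul]
    ring

/-- The fibre of the density bundle `𝓔(w)` over a point with tangent space `V`. -/
def Density (w : ℝ) (n : ℕ) (V : Type*) [AddCommGroup V] [Module ℝ V] : Type _ :=
  densitySubmodule w n V

instance (w : ℝ) (n : ℕ) (V : Type*) [AddCommGroup V] [Module ℝ V] :
    AddCommGroup (Density w n V) :=
  inferInstanceAs (AddCommGroup (densitySubmodule w n V))

instance (w : ℝ) (n : ℕ) (V : Type*) [AddCommGroup V] [Module ℝ V] :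
    Module ℝ (Density w n V) :=
  inferInstanceAs (Module ℝ (densitySubmodule w n V))

open Classical in
/-- The density of weight `w` that takes the value `r` on the frame `B`. -/
def densityOfValue (w : ℝ) {n : ℕ} {V : Type*} [AddCommGroup V] [Module ℝ V]
    (B : Basis (Fin n) ℝ V) : ℝ →ₗ[ℝ] Density w n V where
  toFun r := ⟨fun b => if LinearIndependent ℝ b then |B.det b| ^ (-w / ((n : ℝ) + 1)) * r else 0, by
    refine ⟨fun b hb => by simp [hb], fun f b hb hf => ?_⟩
    have hfb : LinearIndependent ℝ (f ∘ b) :=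
      have : FiniteDimensional ℝ V := B.finiteDimensional_of_finite
      hb.map' f (by
        by_contra hk
        exact hf (LinearMap.det_eq_zero_iff_ker_ne_bot.2 hk))
    simp only [hb, hfb, if_true, Basis.det_comp, abs_mul]
    rw [Real.mul_rpow (abs_nonneg _) (abs_nonneg _)]
    ring⟩
  map_add' r s := Subtype.ext (funext fun b => by
    by_cases hb : LinearIndependent ℝ b
    · exact (if_pos hb).trans ((mul_add _ r s).trans
        (congrArg₂ (· + ·) (if_pos hb).symm (if_pos hb).symm))
    · exact (if_neg hb).trans ((add_zero (0 : ℝ)).symm.trans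
        (congrArg₂ (· + ·) (if_neg hb).symm (if_neg hb).symm)))
  map_smul' c r := Subtype.ext (funext fun b => by
    by_cases hb : LinearIndependent ℝ b
    · exact (if_pos hb).trans ((mul_left_comm _ c r).trans
        (congrArg (c * ·) (if_pos hb).symm))
    · exact (if_neg hb).trans ((mul_zero c).symm.trans (congrArg (c * ·) (if_neg hb).symm)))

lemma Density.eq_zero_of_apply_basis {w : ℝ} {n : ℕ} {V : Type*} [AddCommGroup V] [Module ℝ V]
    (B : Basis (Fin n) ℝ V) (φ : Density w n V) (h : φ.1 B = 0) : φ = 0 := by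
  refine Subtype.ext (funext fun b => ?_)
  change φ.1 b = 0
  by_cases hb : LinearIndependent ℝ b
  · have hB : (B.constr ℝ b : V →ₗ[ℝ] V) ∘ B = b := by
      ext i; simp
    have hdet : LinearMap.det (B.constr ℝ b : V →ₗ[ℝ] V) = B.det b := by
      have := B.det_comp (B.constr ℝ b : V →ₗ[ℝ] V) B
      rw [hB, B.det_self, mul_one] at this
      exact this.symm
    have hspan : ⊤ ≤ Submodule.span ℝ (Set.range b) := by
      have : FiniteDimensional ℝ V := B.finiteDimensional_of_finite
      exact (hb.span_eq_top_of_card_eq_finrank' (by rw [finrank_eq_card_basis B])).ge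
    have hne : LinearMap.det (B.constr ℝ b : V →ₗ[ℝ] V) ≠ 0 := by
      rw [hdet]
      exact (B.is_basis_iff_det.1 ⟨hb, hspan.antisymm' le_top⟩).ne_zero
    have := φ.2.2 _ B B.linearIndependent hne
    rwa [hB, h, mul_zero] at this
  · exact φ.2.1 b hb

end Algebra

variable {n : ℕ} {M : Type*} [TopologicalSpace M] [ChartedSpace (EuclideanSpace ℝ (Fin n)) M]

section Frames

/-- The coordinate frame at `x` of the preferred chart at `x`. -/
def coordFrame (x : M) : Basis (Fin n) ℝ (TangentSpace (𝓡 n) x) :=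
  (EuclideanSpace.basisFun (Fin n) ℝ).toBasis

variable [IsManifold (𝓡 n) ∞ M]

/-- The vector field with constant coefficients in the preferred chart at `x` that extends the
tangent vector `v` at `x` (it is smooth on the domain of this chart). -/
def extendVec {x : M} (v : TangentSpace (𝓡 n) x) (y : M) : TangentSpace (𝓡 n) y :=
  (trivializationAt (EuclideanSpace ℝ (Fin n)) (TangentSpace (𝓡 n)) x).symmₗ ℝ y
    ((trivializationAt (EuclideanSpace ℝ (Fin n)) (TangentSpace (𝓡 n)) x).linearMapAt ℝ x v)

lemma extendVec_self {x : M} (v : TangentSpace (𝓡 n) x) : extendVec v x = v :=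
  Trivialization.symmₗ_linearMapAt _ (FiberBundle.mem_baseSet_trivializationAt' x) v

lemma extendVec_eventuallyEq {x : M} (v : TangentSpace (𝓡 n) x) :
    ∀ᶠ y in 𝓝 x, extendVec v y = FiberBundle.extend (EuclideanSpace ℝ (Fin n)) v y := by
  have hx : x ∈ (trivializationAt (EuclideanSpace ℝ (Fin n)) (TangentSpace (𝓡 n)) x).baseSet :=
    FiberBundle.mem_baseSet_trivializationAt' x
  filter_upwards [(trivializationAt (EuclideanSpace ℝ (Fin n))
    (TangentSpace (𝓡 n)) x).open_baseSet.mem_nhds hx] with y hy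
  rw [extendVec, Trivialization.coe_linearMapAt_of_mem _ hx, Trivialization.coe_symmₗ _ hy]
  rfl

lemma mdifferentiableAt_extendVec {x : M} (v : TangentSpace (𝓡 n) x) :
    MDifferentiableAt (𝓡 n) (𝓡 n).tangent
      (fun y => (⟨y, extendVec v y⟩ : TangentBundle (𝓡 n) M)) x := by
  refine (FiberBundle.mdifferentiableAt_extend (𝓡 n)
    (EuclideanSpace ℝ (Fin n)) v).congr_of_eventuallyEq ?_
  filter_upwards [extendVec_eventuallyEq v] with y hy
  rw [hy]

lemma extendVec_add {x : M} (v w : TangentSpace (𝓡 n) x) :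
    (extendVec (v + w) : Π y : M, TangentSpace (𝓡 n) y) = extendVec v + extendVec w := by
  ext1 y
  simp only [extendVec, map_add, Pi.add_apply]

lemma extendVec_smul {x : M} (c : ℝ) (v : TangentSpace (𝓡 n) x) :
    (extendVec (c • v) : Π y : M, TangentSpace (𝓡 n) y) = c • extendVec v := by
  ext1 y
  simp only [extendVec, map_smul, Pi.smul_apply]

/-- The coordinate frame field of the preferred chart at `x`, evaluated at `y`. -/
def coordFrameField (x y : M) : Fin n → TangentSpace (𝓡 n) y :=
  fun i => extendVec (coordFrame x i) y

lemma coordFrameField_self (x : M) : coordFrameField (n := n) x x = coordFrame x := by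
  ext1 i
  exact extendVec_self (coordFrame x i)

end Frames

section Connections

variable (n M) in
/-- A smooth torsion-free affine connection on `M`. -/
structure AffineConnection [IsManifold (𝓡 n) ∞ M] where
  /-- `cov X x v` is `∇_v X` at `x`. -/
  cov : CovariantDerivative (𝓡 n) (EuclideanSpace ℝ (Fin n)) (TangentSpace (𝓡 n) : M → Type _)
  smooth : cov.ContMDiffCovariantDerivative ∞
  torsion_free : cov.torsion = 0

variable [IsManifold (𝓡 n) ∞ M]

/-- A vector field is smooth. -/
def IsSmoothVectorField (X : Π x : M, TangentSpace (𝓡 n) x) : Prop :=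
  ContMDiff (𝓡 n) (𝓡 n).tangent ∞ (fun x => (⟨x, X x⟩ : TangentBundle (𝓡 n) M))

/-- A `1`-form is smooth. -/
def IsSmoothOneForm (Υ : Π x : M, TangentSpace (𝓡 n) x →L[ℝ] ℝ) : Prop :=
  ∀ X : Π x : M, TangentSpace (𝓡 n) x, IsSmoothVectorField X →
    ContMDiff (𝓡 n) 𝓘(ℝ) ∞ (fun x => Υ x (X x))

/-- Projective equivalence of torsion-free connections:
`∇'_v X = ∇_v X + Υ(v) X + Υ(X) v` for a smooth `1`-form `Υ`. -/
def ProjEquiv (D D' : AffineConnection n M) : Prop :=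
  ∃ Υ : Π x : M, TangentSpace (𝓡 n) x →L[ℝ] ℝ, IsSmoothOneForm Υ ∧
    ∀ (X : Π x : M, TangentSpace (𝓡 n) x) (x : M),
      MDifferentiableAt (𝓡 n) (𝓡 n).tangent (fun y => (⟨y, X y⟩ : TangentBundle (𝓡 n) M)) x →
      ∀ v : TangentSpace (𝓡 n) x,
        D'.cov X x v = D.cov X x v + Υ x v • X x + Υ x (X x) • v

lemma ProjEquiv.equivalence : Equivalence (ProjEquiv (n := n) (M := M)) where
  refl D := ⟨fun _ => 0, fun X _ => by simpa using contMDiff_const, fun X x _ v => by simp⟩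
  symm := by
    rintro D D' ⟨Υ, hΥ, h⟩
    refine ⟨fun x => -Υ x, fun X hX => ?_, fun X x hX v => ?_⟩
    · simpa using! (hΥ X hX).neg
    · rw [h X x hX v]
      simp only [neg_apply]
      module
  trans := by
    rintro D D' D'' ⟨Υ, hΥ, h⟩ ⟨Υ', hΥ', h'⟩
    refine ⟨fun x => Υ x + Υ' x, fun X hX => ?_, fun X x hX v => ?_⟩
    · simpa using! (hΥ X hX).add (hΥ' X hX)
    · rw [h' X x hX v, h X x hX v]
      simp only [add_apply]
      module

variable (n M) in
/-- Projective equivalence as a setoid on torsion-free connections. -/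
def projSetoid : Setoid (AffineConnection n M) := ⟨ProjEquiv, ProjEquiv.equivalence⟩

variable (n M) in
/-- A projective structure on `M`: a projective equivalence class of torsion-free connections. -/
def ProjectiveStructure : Type _ := Quotient (projSetoid n M)

/-- The projective structure `[∇]` of an affine manifold `(M, ∇)`. -/
def AffineConnection.toProjective (D : AffineConnection n M) : ProjectiveStructure n M :=
  Quotient.mk (projSetoid n M) D

namespace AffineConnection

variable (D : AffineConnection n M)

/-- `D.gam x v w` is `∇_v W` at `x`, where `W` extends `w` with constant coefficients in the
preferred chart at `x` (the contraction of the Christoffel symbols with `v` and `w`). -/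
def gam (x : M) :
    TangentSpace (𝓡 n) x →ₗ[ℝ] TangentSpace (𝓡 n) x →ₗ[ℝ] TangentSpace (𝓡 n) x :=
  LinearMap.mk₂ ℝ (fun v w => D.cov (extendVec w) x v)
    (fun v v' w => by simp)
    (fun c v w => by simp)
    (fun v w w' => by
      rw [extendVec_add]
      exact DFunLike.congr_fun (D.cov.isCovariantDerivativeOnUniv.add
        (mdifferentiableAt_extendVec w)
        (mdifferentiableAt_extendVec w')) v)
    (fun c v w => by
      rw [extendVec_smul]
      exact DFunLike.congr_fun (D.cov.isCovariantDerivativeOnUniv.smul_const c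
        (mdifferentiableAt_extendVec w)) v)

/-- The curvature `R(u,v)w = ∇_U ∇_V W - ∇_V ∇_U W - ∇_{[U,V]} W`, where `U, V, W` extend the
tangent vectors `u, v, w` at `x`. -/
def curvature (x : M) (u v w : TangentSpace (𝓡 n) x) : TangentSpace (𝓡 n) x :=
  D.cov (fun y => D.cov (extendVec w) y (extendVec v y)) x u
    - D.cov (fun y => D.cov (extendVec w) y (extendVec u y)) x v
    - D.cov (extendVec w) x (VectorField.mlieBracket (𝓡 n) (extendVec u) (extendVec v) x)

/-- The Ricci tensor `Ric(v,w) = tr (u ↦ R(u,v)w)`. -/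
def ricci (x : M) (v w : TangentSpace (𝓡 n) x) : ℝ :=
  ∑ i, (coordFrame x).coord i (D.curvature x (coordFrame x i) v w)

/-- The projective Schouten tensor: the solution `P` of
`(n-1) P(v,w) = Ric(v,w) + β(v,w)` with `β(v,w) = P(w,v) - P(v,w)`. -/
def schouten (x : M) (v w : TangentSpace (𝓡 n) x) : ℝ :=
  (n * D.ricci x v w + D.ricci x w v) / ((n : ℝ) ^ 2 - 1)

end AffineConnection

end Connections

section Tractors

variable [IsManifold (𝓡 n) ∞ M]

variable (n) in
/-- The (not necessarily smooth) sections of `𝓔(1)`. -/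
def DensitySection (M : Type*) [TopologicalSpace M]
    [ChartedSpace (EuclideanSpace ℝ (Fin n)) M] [IsManifold (𝓡 n) ∞ M] : Type _ :=
  (y : M) → Density 1 n (TangentSpace (𝓡 n) y)

instance : AddCommGroup (DensitySection n M) :=
  inferInstanceAs (AddCommGroup ((y : M) → Density 1 n (TangentSpace (𝓡 n) y)))

instance : Module ℝ (DensitySection n M) :=
  inferInstanceAs (Module ℝ ((y : M) → Density 1 n (TangentSpace (𝓡 n) y)))

/-- The coefficient of a section of `𝓔(1)` in the coordinate frame field of the preferred chart
at `x`. -/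
def coeff (x : M) (σ : DensitySection n M) (y : M) : ℝ :=
  (σ y).1 (coordFrameField x y)

lemma coeff_self (x : M) (σ : DensitySection n M) : coeff x σ x = (σ x).1 (coordFrame x) := by
  rw [coeff, coordFrameField_self]

variable (n) in
/-- The sections of `𝓔(1)` that are smooth at `x`. -/
def smoothSectionsAt (x : M) : Submodule ℝ (DensitySection n M) where
  carrier := {σ | ContMDiffAt (𝓡 n) 𝓘(ℝ) ∞ (coeff x σ) x}
  add_mem' {σ τ} hσ hτ := ContMDiffAt.add hσ hτ
  zero_mem' := contMDiffAt_const (c := (0 : ℝ))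
  smul_mem' c σ hσ := by
    have h : ContMDiffAt (𝓡 n) 𝓘(ℝ) ∞ (fun y => c * coeff x σ y) x :=
      contMDiffAt_const.mul hσ
    exact h

lemma mdifferentiableAt_coeff {x : M} (σ : smoothSectionsAt n x) :
    MDifferentiableAt (𝓡 n) 𝓘(ℝ) (coeff x σ.1) x := by
  have h : ContMDiffAt (𝓡 n) 𝓘(ℝ) ∞ (coeff x σ.1) x := σ.2
  exact h.mdifferentiableAt (by simp)

lemma mvfderiv_coeff_add {x : M} (σ τ : smoothSectionsAt n x) :
    mvfderiv (𝓡 n) (coeff x (σ + τ).1) x =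
      mvfderiv (𝓡 n) (coeff x σ.1) x + mvfderiv (𝓡 n) (coeff x τ.1) x :=
  mvfderiv_add (mdifferentiableAt_coeff σ) (mdifferentiableAt_coeff τ)

lemma mvfderiv_coeff_smul {x : M} (c : ℝ) (σ : smoothSectionsAt n x) :
    mvfderiv (𝓡 n) (coeff x (c • σ).1) x = c • mvfderiv (𝓡 n) (coeff x σ.1) x := by
  have h := mvfderiv_smul (I := 𝓡 n) (a := fun _ : M => c) (x := x)
    mdifferentiableAt_const (mdifferentiableAt_coeff σ)
  have h0 : mvfderiv (𝓡 n) (fun _ : M => c) x = 0 := mvfderiv_const c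
  rw [h0] at h
  ext v
  have h' := DFunLike.congr_fun h v
  simpa using! h'

variable (n) in
/-- The sections of `𝓔(1)` that vanish at `x` to first order. -/
def flatSectionsAt (x : M) : Submodule ℝ (smoothSectionsAt n x) where
  carrier := {σ | coeff x σ.1 x = 0 ∧ mvfderiv (𝓡 n) (coeff x σ.1) x = 0}
  add_mem' {σ τ} hσ hτ := by
    refine ⟨?_, by rw [mvfderiv_coeff_add, hσ.2, hτ.2, add_zero]⟩
    change coeff x σ.1 x + coeff x τ.1 x = 0
    rw [hσ.1, hτ.1, add_zero]
  zero_mem' := by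
    refine ⟨rfl, ?_⟩
    have := mvfderiv_coeff_smul (x := x) (n := n) 0 0
    simpa using this
  smul_mem' c σ hσ := by
    refine ⟨?_, by rw [mvfderiv_coeff_smul, hσ.2, smul_zero]⟩
    change c * coeff x σ.1 x = 0
    rw [hσ.1, mul_zero]

variable (n) in
/-- The fibre at `x` of the cotractor bundle `𝓣* = J¹𝓔(1)`: the `1`-jets at `x` of local
sections of `𝓔(1)`. -/
def Cotractor (x : M) : Type _ := smoothSectionsAt n x ⧸ flatSectionsAt n x

instance (x : M) : AddCommGroup (Cotractor n x) :=
  inferInstanceAs (AddCommGroup (smoothSectionsAt n x ⧸ flatSectionsAt n x))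

instance (x : M) : Module ℝ (Cotractor n x) :=
  inferInstanceAs (Module ℝ (smoothSectionsAt n x ⧸ flatSectionsAt n x))

/-- The canonical tractor `X`, that is, the jet projection `J¹𝓔(1) → 𝓔(1)`. -/
def canonicalX (x : M) : Cotractor n x →ₗ[ℝ] Density 1 n (TangentSpace (𝓡 n) x) :=
  (flatSectionsAt n x).liftQ
    { toFun := fun σ => σ.1 x
      map_add' := fun _ _ => rfl
      map_smul' := fun _ _ => rfl }
    (fun σ hσ => by
      refine Density.eq_zero_of_apply_basis (coordFrame x) _ ?_
      have := hσ.1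
      rwa [coeff_self] at this)

namespace AffineConnection

variable (D : AffineConnection n M)

/-- The trace of `D.gam x v`, the connection form of the frame `∂₁ ∧ ⋯ ∧ ∂ₙ` of `Λⁿ TM`. -/
def traceGam (x : M) (v : TangentSpace (𝓡 n) x) : ℝ :=
  LinearMap.trace ℝ (TangentSpace (𝓡 n) x) (D.gam x v)

/-- The connection on sections of `𝓔(1)` induced by `∇`, with respect to the coordinate frame:
`∇_v σ = dσ(v) + w/(n+1) tr(Γ(v)) σ` on `𝓔(w)`. -/
def covCoeff (x : M) : smoothSectionsAt n x →ₗ[ℝ] TangentSpace (𝓡 n) x →ₗ[ℝ] ℝ :=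
  LinearMap.mk₂ ℝ
    (fun σ v => mvfderiv (𝓡 n) (coeff x σ.1) x v
      + 1 / ((n : ℝ) + 1) * D.traceGam x v * coeff x σ.1 x)
    (fun σ τ v => by
      have h : coeff x (σ + τ).1 x = coeff x σ.1 x + coeff x τ.1 x := rfl
      rw [mvfderiv_coeff_add, h, add_apply]
      ring)
    (fun c σ v => by
      have h : coeff x (c • σ).1 x = c * coeff x σ.1 x := rfl
      rw [mvfderiv_coeff_smul, h, smul_apply, smul_eq_mul, smul_eq_mul]
      ring)
    (fun σ v w => by
      simp only [traceGam, map_add]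
      ring)
    (fun c σ v => by
      simp only [traceGam, map_smul, smul_eq_mul]
      ring)

/-- The map `σ ↦ ∇σ` at `x` on sections of `𝓔(1)` that are smooth at `x`. -/
def covDensity (x : M) : smoothSectionsAt n x →ₗ[ℝ]
    TangentSpace (𝓡 n) x →ₗ[ℝ] Density 1 n (TangentSpace (𝓡 n) x) :=
  (D.covCoeff x).compr₂ (densityOfValue 1 (coordFrame (n := n) x))

/-- The splitting `J¹𝓔(1) → T*M ⊗ 𝓔(1)`, `j¹σ ↦ ∇σ`, of the jet sequence given by the connection
on `𝓔(1)` that `∇` induces. Together with `canonicalX` it identifies a cotractor with the pair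
`(σ, μ) = (σ, ∇σ)`. -/
def splitting (x : M) :
    Cotractor n x →ₗ[ℝ] TangentSpace (𝓡 n) x →ₗ[ℝ] Density 1 n (TangentSpace (𝓡 n) x) :=
  (flatSectionsAt n x).liftQ (D.covDensity x)
    (fun σ hσ => by
      have h : D.covCoeff x σ = 0 := by
        refine LinearMap.ext fun v => ?_
        change mvfderiv (𝓡 n) (coeff x σ.1) x v
          + 1 / ((n : ℝ) + 1) * D.traceGam x v * coeff x σ.1 x = 0
        rw [hσ.1, hσ.2]
        simp
      rw [LinearMap.mem_ker]
      refine LinearMap.ext fun v => ?_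
      rw [covDensity, LinearMap.compr₂_apply, h, LinearMap.zero_apply, map_zero,
        LinearMap.zero_apply])

end AffineConnection

end Tractors

section Curves

variable [IsManifold (𝓡 n) ∞ M]

/-- The velocity `γ'(t)`. -/
def velocity (γ : ℝ → M) (t : ℝ) : TangentSpace (𝓡 n) (γ t) :=
  mfderiv 𝓘(ℝ) (𝓡 n) γ t (1 : ℝ)

/-- `γ : J → M` is a smooth regular (that is, immersed) curve on the open interval `J`. -/
structure IsRegularCurve (γ : ℝ → M) (J : Set ℝ) : Prop where
  isOpen : IsOpen J
  ordConnected : J.OrdConnected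
  nonempty : J.Nonempty
  smooth : ContMDiffOn 𝓘(ℝ) (𝓡 n) ∞ γ J
  velocity_ne_zero : ∀ t ∈ J, velocity (n := n) γ t ≠ 0

/-- The coefficient near `t₀` of a density field along `γ` in the coordinate frame field of the
preferred chart at `γ t₀`. -/
def coeffAlong {w : ℝ} (γ : ℝ → M) (s : (t : ℝ) → Density w n (TangentSpace (𝓡 n) (γ t)))
    (t₀ t : ℝ) : ℝ :=
  (s t).1 (coordFrameField (γ t₀) (γ t))

/-- A field of densities along `γ` is smooth on `J`. -/
def IsSmoothDensityAlong {w : ℝ} (γ : ℝ → M) (J : Set ℝ)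
    (s : (t : ℝ) → Density w n (TangentSpace (𝓡 n) (γ t))) : Prop :=
  ∀ t₀ ∈ J, ContDiffAt ℝ ∞ (coeffAlong γ s t₀) t₀

namespace AffineConnection

variable (D : AffineConnection n M)

/-- The covariant derivative `∇_{γ'} V` at `t` of a vector field `V` along `γ`: the derivative of
the coefficients of `V` in the coordinate frame field of the preferred chart at `γ t`, plus the
Christoffel term. -/
def vectorDerivAlong (γ : ℝ → M) (V : (t : ℝ) → TangentSpace (𝓡 n) (γ t)) (t : ℝ) :
    TangentSpace (𝓡 n) (γ t) :=
  let e := trivializationAt (EuclideanSpace ℝ (Fin n)) (TangentSpace (𝓡 n)) (γ t)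
  e.symmₗ ℝ (γ t) (deriv (fun s => (e ⟨γ s, V s⟩).2) t) + D.gam (γ t) (velocity γ t) (V t)

/-- The covariant derivative `∇_{γ'} s` at `t` of a field `s` of densities of weight `w`
along `γ`. -/
def densityDerivAlong {w : ℝ} (γ : ℝ → M)
    (s : (t : ℝ) → Density w n (TangentSpace (𝓡 n) (γ t))) (t : ℝ) :
    Density w n (TangentSpace (𝓡 n) (γ t)) :=
  densityOfValue w (coordFrame (γ t)) (deriv (coeffAlong γ s t) t
    + w / ((n : ℝ) + 1) * D.traceGam (γ t) (velocity γ t) * coeffAlong γ s t t)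

/-- The covariant derivative `∇_{γ'} μ` at `t` of a field `μ` of `𝓔(1)`-valued `1`-forms on `M`
along `γ`, by the Leibniz rule. -/
def formDerivAlong (γ : ℝ → M)
    (μ : (t : ℝ) → TangentSpace (𝓡 n) (γ t) →ₗ[ℝ] Density 1 n (TangentSpace (𝓡 n) (γ t)))
    (t : ℝ) (v : TangentSpace (𝓡 n) (γ t)) : Density 1 n (TangentSpace (𝓡 n) (γ t)) :=
  D.densityDerivAlong γ (fun s => μ s (extendVec v (γ s))) t
    - μ t (D.gam (γ t) (velocity γ t) v)

/-- `γ` is an unparametrised (oriented) geodesic of `∇`: it admits a velocity field `u = f γ'`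
with `f > 0`, that is, one compatible with the orientation, such that `∇_u u = 0`. -/
def IsUnparamGeodesic (γ : ℝ → M) (J : Set ℝ) : Prop :=
  ∃ f : ℝ → ℝ, ContDiffOn ℝ ∞ f J ∧ (∀ t ∈ J, 0 < f t) ∧
    ∀ t ∈ J, f t • D.vectorDerivAlong γ (fun s => f s • velocity γ s) t = 0

/-- A field of cotractors along `γ` is smooth on `J`: both of its components in the splitting
given by `∇` are smooth. -/
def IsSmoothCotractorAlong (γ : ℝ → M) (J : Set ℝ) (α : (t : ℝ) → Cotractor n (γ t)) : Prop :=
  IsSmoothDensityAlong γ J (fun t => canonicalX (γ t) (α t)) ∧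
  ∀ t₀ ∈ J, ∀ v : TangentSpace (𝓡 n) (γ t₀), ContDiffAt ℝ ∞
    (coeffAlong γ (fun t => D.splitting (γ t) (α t) (extendVec v (γ t))) t₀) t₀

/-- `α'` is the derivative `∇_{γ'} α` at `t` for the cotractor connection
`∇_a (σ, μ_b) = (∇_a σ - μ_a, ∇_a μ_b + P_{ab} σ)`. -/
def IsCotractorDeriv (γ : ℝ → M) (α : (t : ℝ) → Cotractor n (γ t)) (t : ℝ)
    (α' : Cotractor n (γ t)) : Prop :=
  canonicalX (γ t) α' = D.densityDerivAlong γ (fun s => canonicalX (γ s) (α s)) t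
      - D.splitting (γ t) (α t) (velocity γ t) ∧
  ∀ v : TangentSpace (𝓡 n) (γ t), D.splitting (γ t) α' v =
    D.formDerivAlong γ (fun s => D.splitting (γ s) (α s)) t v
      + D.schouten (γ t) (velocity γ t) v • canonicalX (γ t) (α t)

end AffineConnection

variable (n) in
/-- The fibre at `x` of `Λ²𝓣`, where `𝓣` is the dual of the finite-dimensional bundle `𝓣*`: the
skew contravariant tensors `Σ^{αβ}`, that is, the alternating bilinear forms on `𝓣*`. -/
abbrev TwoTractor (x : M) : Type _ := Cotractor n x [⋀^Fin 2]→ₗ[ℝ] ℝ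

/-- The incidence relation `X ∧ Σ = 0`, that is, `X^{[α} Σ^{βγ]} = 0`, in `Λ³𝓣(1)`. -/
def Incident (x : M) (S : TwoTractor n x) : Prop :=
  ∀ α β δ : Cotractor n x,
    S ![β, δ] • canonicalX x α + S ![δ, α] • canonicalX x β + S ![α, β] • canonicalX x δ = 0

namespace AffineConnection

variable (D : AffineConnection n M)

/-- A field of `2`-tractors along `γ` is smooth on `J`. -/
def IsSmoothTwoTractorAlong (γ : ℝ → M) (J : Set ℝ) (S : (t : ℝ) → TwoTractor n (γ t)) : Prop :=
  ∀ α β : (t : ℝ) → Cotractor n (γ t),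
    D.IsSmoothCotractorAlong γ J α → D.IsSmoothCotractorAlong γ J β →
    ContDiffOn ℝ ∞ (fun t => S t ![α t, β t]) J

/-- A field `Σ` of `2`-tractors along `γ` is parallel on `J` for the connection on `Λ²𝓣` that the
cotractor connection induces:
`(Σ(α, β))' = Σ(∇_{γ'} α, β) + Σ(α, ∇_{γ'} β)` for all smooth cotractor fields `α`, `β`
along `γ`. -/
def IsParallelAlong (γ : ℝ → M) (J : Set ℝ) (S : (t : ℝ) → TwoTractor n (γ t)) : Prop :=
  ∀ α β : (t : ℝ) → Cotractor n (γ t),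
    D.IsSmoothCotractorAlong γ J α → D.IsSmoothCotractorAlong γ J β →
    ∀ t ∈ J, ∀ α' β' : Cotractor n (γ t),
      D.IsCotractorDeriv γ α t α' → D.IsCotractorDeriv γ β t β' →
      HasDerivAt (fun s => S s ![α s, β s]) (S t ![α', β t] + S t ![α t, β']) t

/-- `Σ` is a nonzero smooth `2`-tractor along `γ` that is parallel for the tractor connection and
satisfies `X ∧ Σ = 0`. -/
structure IsGeodesicTractor (γ : ℝ → M) (J : Set ℝ) (S : (t : ℝ) → TwoTractor n (γ t)) :
    Prop where
  smooth : D.IsSmoothTwoTractorAlong γ J S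
  parallel : D.IsParallelAlong γ J S
  ne_zero : ∃ t ∈ J, S t ≠ 0
  incident : ∀ t ∈ J, Incident (γ t) (S t)

/-- `Σ` is compatible with the orientation of `γ`: at each point `Σ^{αβ} = 2 X^{[α} W^{β]}_b 𝐮^b`,
where `𝐮 = ρ ⊗ γ' ∈ Tγ(-2)` for a positive density `ρ` of weight `-2`. (Here
`2 X^{[α} W^{β]}_b 𝐮^b α_α β_β = X(α) μ_β(𝐮) - X(β) μ_α(𝐮)`, with the product
`𝓔(-2) ⊗ 𝓔(1) ⊗ 𝓔(1) → ℝ` evaluated in the coordinate frame.) -/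
def IsOriented (γ : ℝ → M) (J : Set ℝ) (S : (t : ℝ) → TwoTractor n (γ t)) : Prop :=
  ∀ t ∈ J, ∃ ρ : Density (-2) n (TangentSpace (𝓡 n) (γ t)), 0 < ρ.1 (coordFrame (γ t)) ∧
    ∀ α β : Cotractor n (γ t), S t ![α, β] =
      ρ.1 (coordFrame (γ t)) *
        ((canonicalX (γ t) α).1 (coordFrame (γ t)) *
            (D.splitting (γ t) β (velocity γ t)).1 (coordFrame (γ t)) -
          (canonicalX (γ t) β).1 (coordFrame (γ t)) *
            (D.splitting (γ t) α (velocity γ t)).1 (coordFrame (γ t)))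

end AffineConnection

/-- `γ` is an unparametrised geodesic of the projective structure `p`, that is, of some
connection in the class. -/
def ProjectiveStructure.IsUnparamGeodesic (p : ProjectiveStructure n M) (γ : ℝ → M)
    (J : Set ℝ) : Prop :=
  ∃ D : AffineConnection n M, D.toProjective = p ∧ D.IsUnparamGeodesic γ J

end Curves

end ProjectiveTractor

end

/-! ### Densities and the coordinate frames of the preferred charts. -/

noncomputable section

namespace ProjectiveTractor

section Algebra

variable {n : ℕ} {V : Type*} [AddCommGroup V] [Module ℝ V]

/-! Fix a positive density `ρ` of weight `-2` along `γ` (`exists_pos_density`) and put `Σ_ρ(α, α') =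
ρ (σ μ'(γ') - σ' μ(γ'))` (`curveTractor`). Everything reduces to one linear equation for a scalar
function `k` along `γ`: the field `k ρ ⊗ γ'` is parallel, that is, `k' γ' + k A = 0` with `A = ρ⁻¹
∇_{γ'}(ρ ⊗ γ')` (`weightedAccel`).

Tractors. Incidence means `Σ = X ∧ W`, so `Σ` vanishes on pairs of cotractors with `σ = 0`. The
tractor derivative of a field `(0, μ)` has first component `-μ(γ')`; differentiating `Σ(α, β) = 0`
for two such fields therefore forces `W`, modulo `X`, to be a multiple of `γ'`. Hence `Σ = k Σ_ρ`
(`exists_eq_smul_curveTractor`). By the Leibniz rule (`hasDerivAt_curveTractor`) the failure of `k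
Σ_ρ` to be parallel is `ρ (σ μ'(Z) - σ' μ(Z))` with `Z = k' γ' + k A`; the Schouten terms are
symmetric in the two cotractors and cancel. So `Σ` is parallel if and only if `Z = 0`
(`isGeodesicTractor_iff`).

Geodesics. If `Θ` is an antiderivative of `ρ⁻¹ ∇_{γ'} ρ`, then `e^{-Θ} ρ` is parallel, so `∇_{γ'}(f
γ') = 0` if and only if `k = e^{-Θ} f` solves the equation (`isUnparamGeodesic_iff`). Geodesics thus
correspond to positive solutions `k`.

Solutions. Paired with a covector that does not annihilate `γ'`, the equation gives a linear
ordinary differential equation for `k`. A solution that is not identically zero has no zero, hence a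
constant sign (`pos_or_neg_of_transport`), and two solutions are proportional
(`exists_eq_mul_of_transport`). This gives existence from any nonzero tractor, uniqueness up to a
constant, and the statement on orientations.

Projective invariance. A change of connection by `Υ` adds `Υ σ` to `μ`, which does not affect `Σ_ρ`;
it adds `-2 Υ(γ')` to `ρ⁻¹ ∇_{γ'} ρ` and `2 Υ(γ') γ'` to `∇_{γ'} γ'`, so `A` is unchanged. The
weight `-2` is chosen for this. No transformation law for the Schouten tensor is needed.

A recurring technical point is that the derivatives along `γ` at `t` are defined in the preferred
chart at `γ t`, which depends on `t` without any regularity. They must be rewritten in a fixed chart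
before their smoothness in `t` can be discussed. -/

lemma densityOfValue_apply {w : ℝ} (B b : Basis (Fin n) ℝ V) (r : ℝ) :
    (densityOfValue w B r).1 b = |B.det b| ^ (-w / ((n : ℝ) + 1)) * r :=
  if_pos b.linearIndependent

lemma densityOfValue_apply_self {w : ℝ} (B : Basis (Fin n) ℝ V) (r : ℝ) :
    (densityOfValue w B r).1 B = r := by
  rw [densityOfValue_apply, B.det_self, abs_one, Real.one_rpow, one_mul]

lemma densityOfValue_self {w : ℝ} (B : Basis (Fin n) ℝ V) (φ : Density w n V) :
    densityOfValue w B (φ.1 B) = φ := by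
  rw [← sub_eq_zero]
  refine Density.eq_zero_of_apply_basis B _ ?_
  change (densityOfValue w B (φ.1 B)).1 B - φ.1 B = 0
  rw [densityOfValue_apply_self, sub_self]

lemma Density.apply_basis {w : ℝ} (φ : Density w n V) (B b : Basis (Fin n) ℝ V) :
    φ.1 b = |B.det b| ^ (-w / ((n : ℝ) + 1)) * φ.1 B := by
  conv_lhs => rw [← densityOfValue_self B φ]
  exact densityOfValue_apply B b _

lemma Density.ext_basis {w : ℝ} (B : Basis (Fin n) ℝ V) {φ ψ : Density w n V}
    (h : φ.1 B = ψ.1 B) : φ = ψ := by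
  rw [← densityOfValue_self B φ, h, densityOfValue_self]

lemma Density.add_apply {w : ℝ} (φ ψ : Density w n V) (b : Fin n → V) :
    (φ + ψ).1 b = φ.1 b + ψ.1 b := rfl

lemma Density.sub_apply {w : ℝ} (φ ψ : Density w n V) (b : Fin n → V) :
    (φ - ψ).1 b = φ.1 b - ψ.1 b := rfl

lemma Density.smul_apply {w : ℝ} (c : ℝ) (φ : Density w n V) (b : Fin n → V) :
    (c • φ).1 b = c * φ.1 b := rfl

lemma Density.zero_apply {w : ℝ} (b : Fin n → V) : (0 : Density w n V).1 b = 0 := rfl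

/-- The value of a density on a frame, as a linear form. -/
def Density.eval (w : ℝ) (b : Fin n → V) : Density w n V →ₗ[ℝ] ℝ where
  toFun φ := φ.1 b
  map_add' _ _ := rfl
  map_smul' _ _ := rfl

lemma abs_det_pos (B b : Basis (Fin n) ℝ V) : 0 < |B.det b| :=
  abs_pos.2 (B.isUnit_det b).ne_zero

/-- The product `𝓔(-2) ⊗ 𝓔(1) ⊗ 𝓔(1) → ℝ` does not depend on the frame. -/
lemma Density.mul_mul_apply (ρ : Density (-2) n V) (φ ψ : Density 1 n V)
    (B b : Basis (Fin n) ℝ V) : ρ.1 b * (φ.1 b * ψ.1 b) = ρ.1 B * (φ.1 B * ψ.1 B) := by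
  rw [ρ.apply_basis B b, φ.apply_basis B b, ψ.apply_basis B b]
  have h : |B.det b| ^ (-(-2 : ℝ) / ((n : ℝ) + 1)) * (|B.det b| ^ (-(1 : ℝ) / ((n : ℝ) + 1)) *
      |B.det b| ^ (-(1 : ℝ) / ((n : ℝ) + 1))) = 1 := by
    rw [← Real.rpow_add (abs_det_pos B b), ← Real.rpow_add (abs_det_pos B b)]
    ring_nf
    exact Real.rpow_zero _
  linear_combination (ρ.1 B * φ.1 B * ψ.1 B) * h

end Algebra

variable {n : ℕ} {M : Type*} [TopologicalSpace M] [ChartedSpace (EuclideanSpace ℝ (Fin n)) M]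

section Frames

/-- The domain of the preferred chart at `x`. -/
abbrev chartDomain (x : M) : Set M := (chartAt (EuclideanSpace ℝ (Fin n)) x).source

lemma isOpen_chartDomain (x : M) : IsOpen (chartDomain (n := n) x) :=
  (chartAt (EuclideanSpace ℝ (Fin n)) x).open_source

lemma mem_chartDomain (x : M) : x ∈ chartDomain (n := n) x :=
  mem_chart_source _ x

variable [IsManifold (𝓡 n) ∞ M]

/-- The components of a tangent vector at `y` in the preferred chart at `x`. -/
def chartCoord (x y : M) : TangentSpace (𝓡 n) y →ₗ[ℝ] EuclideanSpace ℝ (Fin n) :=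
  (trivializationAt (EuclideanSpace ℝ (Fin n)) (TangentSpace (𝓡 n)) x).linearMapAt ℝ y

/-- The tangent vector at `y` with given components in the preferred chart at `x`. -/
def chartVec (x y : M) : EuclideanSpace ℝ (Fin n) →ₗ[ℝ] TangentSpace (𝓡 n) y :=
  (trivializationAt (EuclideanSpace ℝ (Fin n)) (TangentSpace (𝓡 n)) x).symmₗ ℝ y

lemma chartCoord_apply {x y : M} (hy : y ∈ chartDomain (n := n) x) (v : TangentSpace (𝓡 n) y) :
    chartCoord x y v =
      (trivializationAt (EuclideanSpace ℝ (Fin n)) (TangentSpace (𝓡 n)) x ⟨y, v⟩).2 := by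
  rw [chartCoord, Trivialization.coe_linearMapAt_of_mem _ hy]

lemma chartCoord_chartVec {x y : M} (hy : y ∈ chartDomain (n := n) x)
    (w : EuclideanSpace ℝ (Fin n)) : chartCoord x y (chartVec x y w) = w :=
  Trivialization.linearMapAt_symmₗ _ hy _

lemma chartVec_chartCoord {x y : M} (hy : y ∈ chartDomain (n := n) x)
    (v : TangentSpace (𝓡 n) y) : chartVec x y (chartCoord x y v) = v :=
  Trivialization.symmₗ_linearMapAt _ hy _

lemma extendVec_eq {x : M} (v : TangentSpace (𝓡 n) x) (y : M) :
    extendVec v y = chartVec x y (chartCoord x x v) := rfl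

lemma extendVec_chartVec {x : M} (w : EuclideanSpace ℝ (Fin n)) (y : M) :
    extendVec (chartVec x x w) y = chartVec x y w := by
  rw [extendVec_eq, chartCoord_chartVec (mem_chartDomain x)]

/-- The components in the preferred chart at `x` as a linear equivalence. -/
def chartEquiv {x y : M} (hy : y ∈ chartDomain (n := n) x) :
    TangentSpace (𝓡 n) y ≃ₗ[ℝ] EuclideanSpace ℝ (Fin n) :=
  LinearEquiv.ofLinearMap (chartCoord x y) (chartVec x y)
    (LinearMap.ext fun v => chartCoord_chartVec hy v)
    (LinearMap.ext fun v => chartVec_chartCoord hy v)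

/-- The coordinate frame at `y` of the preferred chart at `x`. -/
def frameBasis {x y : M} (hy : y ∈ chartDomain (n := n) x) :
    Basis (Fin n) ℝ (TangentSpace (𝓡 n) y) :=
  (EuclideanSpace.basisFun (Fin n) ℝ).toBasis.map (chartEquiv hy).symm

/-- The tangent space at `x` is the model space itself, and the trivialization belonging to the
preferred chart at `x` is the identity on the fibre over its own centre (`coordChange_self`). -/
lemma chartCoord_coordFrame (x : M) (i : Fin n) :
    chartCoord x x (coordFrame x i) = EuclideanSpace.single i 1 := by
  have h := TangentBundle.continuousLinearMapAt_trivializationAt_eq_core (𝕜 := ℝ) (I := 𝓡 n)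
    (mem_chart_source (EuclideanSpace ℝ (Fin n)) x)
  have h' := DFunLike.congr_fun h (coordFrame x i)
  refine (h' : chartCoord x x (coordFrame x i) = _).trans ?_
  refine ((tangentBundleCore (𝓡 n) M).coordChange_self _ _ (mem_chart_source _ x) _).trans ?_
  refine (congrFun (OrthonormalBasis.coe_toBasis _) i).trans ?_
  exact EuclideanSpace.basisFun_apply _ _ _

lemma coordFrameField_apply (x y : M) (i : Fin n) :
    coordFrameField x y i = chartVec x y (EuclideanSpace.single i 1) := by
  rw [coordFrameField, extendVec_eq, chartCoord_coordFrame]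

lemma coe_frameBasis {x y : M} (hy : y ∈ chartDomain (n := n) x) :
    (frameBasis hy : Fin n → TangentSpace (𝓡 n) y) = coordFrameField x y := by
  ext1 i
  rw [coordFrameField_apply, frameBasis, Basis.map_apply, OrthonormalBasis.coe_toBasis,
    EuclideanSpace.basisFun_apply]
  rfl

lemma frameBasis_repr {x y : M} (hy : y ∈ chartDomain (n := n) x) (v : TangentSpace (𝓡 n) y)
    (i : Fin n) : (frameBasis hy).repr v i = chartCoord x y v i := by
  rw [frameBasis, Basis.map_repr, LinearEquiv.trans_apply, OrthonormalBasis.coe_toBasis_repr_apply,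
    EuclideanSpace.basisFun_repr]
  rfl

/-- A tangent vector as a combination of the coordinate frame. -/
lemma sum_chartCoord_smul {x y : M} (hy : y ∈ chartDomain (n := n) x) (v : TangentSpace (𝓡 n) y) :
    ∑ i, chartCoord x y v i • chartVec x y (EuclideanSpace.single i 1) = v := by
  conv_rhs => rw [← (frameBasis hy).sum_repr v]
  simp only [frameBasis_repr, coe_frameBasis, coordFrameField_apply]

lemma contMDiffAt_chartVec {x y : M} (hy : y ∈ chartDomain (n := n) x)
    (w : EuclideanSpace ℝ (Fin n)) : ContMDiffAt (𝓡 n) (𝓡 n).tangent ∞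
      (fun z => (⟨z, chartVec x z w⟩ : TangentBundle (𝓡 n) M)) y := by
  refine ((trivializationAt (EuclideanSpace ℝ (Fin n)) (TangentSpace (𝓡 n)) x).contMDiffAt_iff
    (n := ∞) (f := fun z => (⟨z, chartVec x z w⟩ : TangentBundle (𝓡 n) M)) hy).2
    ⟨contMDiffAt_id, ?_⟩
  refine (contMDiffAt_const (c := w)).congr_of_eventuallyEq ?_
  filter_upwards [(isOpen_chartDomain x).mem_nhds hy] with z hz
  rw [← chartCoord_apply hz, chartCoord_chartVec hz]

end Frames

end ProjectiveTractor

end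

/-! ### The fibre of the cotractor bundle: a cotractor is a pair `(σ, μ)`. -/

noncomputable section

namespace ProjectiveTractor

variable {n : ℕ} {M : Type*} [TopologicalSpace M] [ChartedSpace (EuclideanSpace ℝ (Fin n)) M]
  [IsManifold (𝓡 n) ∞ M]

section CotractorFibre

/-- An affine function of the chart realises every `1`-jet, because the differential of the chart at
`x` is the isomorphism `chartCoord x x`. -/
lemma exists_coeff_jet (x : M) (r : ℝ) (l : TangentSpace (𝓡 n) x →ₗ[ℝ] ℝ) :
    ∃ c : M → ℝ, ContMDiffAt (𝓡 n) 𝓘(ℝ) ∞ c x ∧ c x = r ∧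
      ∀ v, mvfderiv (𝓡 n) c x v = l v := by
  let L : EuclideanSpace ℝ (Fin n) →L[ℝ] ℝ := LinearMap.toContinuousLinearMap (l ∘ₗ chartVec x x)
  let A : EuclideanSpace ℝ (Fin n) → ℝ := fun w => r + L (w - extChartAt (𝓡 n) x x)
  have hA : HasFDerivAt A L (extChartAt (𝓡 n) x x) := by
    have := (L.hasFDerivAt (x := extChartAt (𝓡 n) x x)).sub_const (L (extChartAt (𝓡 n) x x))
    simpa only [A, map_sub] using this.const_add r
  have hAs : ContDiff ℝ ∞ A := by
    exact contDiff_const.add (L.contDiff.comp (contDiff_id.sub contDiff_const))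
  have he : ContMDiffAt (𝓡 n) 𝓘(ℝ, EuclideanSpace ℝ (Fin n)) ∞ (extChartAt (𝓡 n) x) x :=
    contMDiffAt_extChartAt
  refine ⟨A ∘ extChartAt (𝓡 n) x, hAs.contMDiff.contMDiffAt.comp x he, by simp [A], fun v => ?_⟩
  have hc := mvfderiv_comp (I := 𝓘(ℝ, EuclideanSpace ℝ (Fin n))) (I' := 𝓡 n) (g := A) x
    (hAs.contMDiff.contMDiffAt.mdifferentiableAt (by simp)) (he.mdifferentiableAt (by simp))
  rw [hc]
  have h1 : mfderiv (𝓡 n) 𝓘(ℝ, EuclideanSpace ℝ (Fin n)) (extChartAt (𝓡 n) x) x v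
      = chartCoord x x v := by
    have := DFunLike.congr_fun (TangentBundle.continuousLinearMapAt_trivializationAt (𝕜 := ℝ)
      (I := 𝓡 n) (mem_chart_source (EuclideanSpace ℝ (Fin n)) x)) v
    exact this.symm
  have h2 : ∀ w : EuclideanSpace ℝ (Fin n),
      mvfderiv 𝓘(ℝ, EuclideanSpace ℝ (Fin n)) A (extChartAt (𝓡 n) x x) w = L w := by
    intro w
    have : mfderiv 𝓘(ℝ, EuclideanSpace ℝ (Fin n)) 𝓘(ℝ) A (extChartAt (𝓡 n) x x) = L := by
      rw [mfderiv_eq_fderiv]; exact hA.fderiv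
    change mfderiv 𝓘(ℝ, EuclideanSpace ℝ (Fin n)) 𝓘(ℝ) A (extChartAt (𝓡 n) x x) w = L w
    rw [this]
    rfl
  refine (h2 _).trans ?_
  refine (congrArg L h1).trans ?_
  exact congrArg l (chartVec_chartCoord (mem_chartDomain (n := n) x) v)

open Classical in
-- The coefficient from `exists_coeff_jet` is placed on the coordinate frame inside the chart. The
-- value `0` outside is harmless, since only the germ at `x` matters.
lemma exists_section_jet (x : M) (r : ℝ) (l : TangentSpace (𝓡 n) x →ₗ[ℝ] ℝ) :
    ∃ σ : smoothSectionsAt n x, coeff x σ.1 x = r ∧ ∀ v, mvfderiv (𝓡 n) (coeff x σ.1) x v = l v := by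
  obtain ⟨c, hc, hcx, hcd⟩ := exists_coeff_jet x r l
  let σ : DensitySection n M := fun y =>
    if hy : y ∈ chartDomain (n := n) x then densityOfValue 1 (frameBasis hy) (c y) else 0
  have hσ : coeff x σ =ᶠ[𝓝 x] c := by
    filter_upwards [(isOpen_chartDomain (n := n) x).mem_nhds (mem_chartDomain x)] with y hy
    rw [coeff, ← coe_frameBasis hy]
    simp only [σ, dif_pos hy]
    exact densityOfValue_apply_self _ _
  refine ⟨⟨σ, (hc.congr_of_eventuallyEq hσ :)⟩, hσ.self_of_nhds.trans hcx, fun v => ?_⟩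
  rw [← hcd v, mvfderiv, mvfderiv, hσ.mfderiv_eq]
  change _ = (NormedSpace.fromTangentSpace (c x)) (mfderiv (𝓡 n) 𝓘(ℝ) c x v)
  rfl

variable (D : AffineConnection n M)

/-- Together with `cotractor_ext` this is the isomorphism `J¹𝓔(1) ≅ 𝓔(1) ⊕ T*M ⊗ 𝓔(1)` given by `∇`.
It allows cotractor fields to be prescribed by their components. -/
lemma AffineConnection.exists_cotractor (x : M) (φ : Density 1 n (TangentSpace (𝓡 n) x))
    (μ : TangentSpace (𝓡 n) x →ₗ[ℝ] Density 1 n (TangentSpace (𝓡 n) x)) :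
    ∃ α : Cotractor n x, canonicalX x α = φ ∧ D.splitting x α = μ := by
  let r := φ.1 (coordFrame x)
  -- Since `∇σ = dσ + (connection form) σ`, the differential to prescribe is `μ` minus the
  -- connection form times `r`.
  obtain ⟨σ, h1, h2⟩ := exists_section_jet x r ((Density.eval 1 (coordFrame x)) ∘ₗ μ -
    (1 / ((n : ℝ) + 1) * r) • LinearMap.trace ℝ (TangentSpace (𝓡 n) x) ∘ₗ D.gam x)
  refine ⟨Submodule.Quotient.mk σ, ?_, LinearMap.ext fun v => ?_⟩
  · refine Density.ext_basis (coordFrame x) ?_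
    rw [coeff_self (n := n)] at h1
    exact h1
  · refine Density.ext_basis (coordFrame x) ?_
    refine (densityOfValue_apply_self _ _).trans ?_
    change mvfderiv (𝓡 n) (coeff x σ.1) x v
      + 1 / ((n : ℝ) + 1) * D.traceGam x v * coeff x σ.1 x = (μ v).1 (coordFrame x)
    rw [h1, h2]
    change (μ v).1 (coordFrame x) - (1 / ((n : ℝ) + 1) * r) * D.traceGam x v + _ = _
    ring

/-- Where `σ` vanishes, `∇σ = dσ`; so a jet both of whose components vanish is zero. -/
lemma AffineConnection.cotractor_ext {x : M} {α β : Cotractor n x}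
    (h1 : canonicalX x α = canonicalX x β) (h2 : D.splitting x α = D.splitting x β) : α = β := by
  rw [← sub_eq_zero]
  rw [← sub_eq_zero, ← map_sub] at h1 h2
  obtain ⟨σ, hσ⟩ := Submodule.Quotient.mk_surjective (flatSectionsAt n x) (α - β)
  have h0 : coeff x σ.1 x = 0 := by
    rw [← hσ] at h1
    rw [coeff_self (n := n)]
    exact congrArg (fun φ : Density 1 n (TangentSpace (𝓡 n) x) => φ.1 (coordFrame x)) h1
  refine hσ.symm.trans ((Submodule.Quotient.mk_eq_zero _).2 ⟨h0, ?_⟩)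
  refine ContinuousLinearMap.ext fun v => ?_
  rw [← hσ] at h2
  have h3 : mvfderiv (𝓡 n) (coeff x σ.1) x v
      + 1 / ((n : ℝ) + 1) * D.traceGam x v * coeff x σ.1 x = 0 := by
    refine (densityOfValue_apply_self (w := 1) (coordFrame (n := n) x) _).symm.trans ?_
    exact congrArg (fun μ : TangentSpace (𝓡 n) x →ₗ[ℝ] Density 1 n (TangentSpace (𝓡 n) x) =>
      (μ v).1 (coordFrame x)) h2
  rw [h0, mul_zero, add_zero] at h3
  exact h3

end CotractorFibre

end ProjectiveTractor

end

/-! ### Jacobi's formula, and covariant derivatives in terms of components. -/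

noncomputable section

namespace ProjectiveTractor

section Determinant

variable {E ι : Type*} [NormedAddCommGroup E] [NormedSpace ℝ E] [FiniteDimensional ℝ E]
  [Fintype ι] [DecidableEq ι]

/-- The determinant with respect to a basis as a continuous multilinear map. -/
def detCMM (B : Basis ι ℝ E) : ContinuousMultilinearMap ℝ (fun _ : ι => E) ℝ where
  toMultilinearMap := B.det.toMultilinearMap
  cont := by
    change Continuous fun v => B.det v
    simp only [Basis.det_apply]
    refine Continuous.matrix_det ?_
    refine continuous_pi fun i => continuous_pi fun j => ?_
    simp only [Basis.toMatrix_apply]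
    exact (B.coord i).continuous_of_finiteDimensional.comp (continuous_apply j)

lemma contDiffAt_det (B : Basis ι ℝ E) {b : ι → ℝ → E} {t : ℝ} {k : WithTop ℕ∞}
    (hb : ∀ i, ContDiffAt ℝ k (b i) t) : ContDiffAt ℝ k (fun s => B.det fun i => b i s) t :=
  (detCMM B).contDiff.contDiffAt.comp t (contDiffAt_pi.2 hb)

/-- Jacobi's formula for the derivative of the determinant of a moving frame. -/
lemma hasDerivAt_det (B : Basis ι ℝ E) {b : ι → ℝ → E} {b' : ι → E} {t : ℝ} (e : Basis ι ℝ E)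
    (he : ∀ i, b i t = e i) (hb : ∀ i, HasDerivAt (b i) (b' i) t) :
    HasDerivAt (fun s => B.det fun i => b i s) (B.det e * ∑ i, e.repr (b' i) i) t := by
  have h := ((detCMM B).hasFDerivAt (fun i => b i t)).comp_hasDerivAt t (hasDerivAt_pi.2 hb)
  refine h.congr_deriv ?_
  rw [ContinuousMultilinearMap.linearDeriv_apply, Finset.mul_sum]
  refine Finset.sum_congr rfl fun i _ => ?_
  have hbe : (fun i => b i t) = e := funext he
  rw [hbe]
  -- Cramer's rule: replacing `e i` by `b' i` multiplies the determinant by the `i`-th coordinate of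
  -- `b' i`.
  have := DFunLike.congr_fun
    (B.det_smul_mk_coord_eq_det_update e.linearIndependent e.span_eq.ge i) (b' i)
  rw [LinearMap.smul_apply, smul_eq_mul, Basis.coord_apply] at this
  have he' : Basis.mk e.linearIndependent e.span_eq.ge = e := 
    Basis.eq_of_apply_eq fun j => Basis.mk_apply _ _ j
  rw [he'] at this
  exact this.symm

lemma trace_eq_sum_repr {V : Type*} [AddCommGroup V] [Module ℝ V] (e : Basis ι ℝ V)
    (f : V →ₗ[ℝ] V) : LinearMap.trace ℝ V f = ∑ i, e.repr (f (e i)) i := by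
  rw [LinearMap.trace_eq_matrix_trace ℝ e, Matrix.trace]
  simp [LinearMap.toMatrix_apply]

end Determinant

variable {n : ℕ} {M : Type*} [TopologicalSpace M] [ChartedSpace (EuclideanSpace ℝ (Fin n)) M]

lemma hasDerivAt_comp_curve {F : Type*} [NormedAddCommGroup F] [NormedSpace ℝ F] {f : M → F}
    {γ : ℝ → M} {t : ℝ} (hf : MDifferentiableAt (𝓡 n) 𝓘(ℝ, F) f (γ t))
    (hγ : MDifferentiableAt 𝓘(ℝ) (𝓡 n) γ t) :
    HasDerivAt (fun s => f (γ s)) (mvfderiv (𝓡 n) f (γ t) (velocity γ t)) t := by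
  have h : HasFDerivAt (f ∘ γ)
      ((mvfderiv (𝓡 n) f (γ t)).comp (mfderiv 𝓘(ℝ) (𝓡 n) γ t) : ℝ →L[ℝ] F) t :=
    (hasMFDerivAt_iff_hasFDerivAt (f := f ∘ γ)).1 (hf.hasMFDerivAt.comp t hγ.hasMFDerivAt)
  exact h.hasDerivAt

lemma mvfderiv_clm_comp {F G : Type*} [NormedAddCommGroup F] [NormedSpace ℝ F]
    [NormedAddCommGroup G] [NormedSpace ℝ G] (L : F →L[ℝ] G) {f : M → F} {x : M}
    (hf : MDifferentiableAt (𝓡 n) 𝓘(ℝ, F) f x) (v : TangentSpace (𝓡 n) x) :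
    mvfderiv (𝓡 n) (fun y => L (f y)) x v = L (mvfderiv (𝓡 n) f x v) := by
  have h := (L.hasMFDerivAt.comp x hf.hasMFDerivAt).mfderiv
  exact DFunLike.congr_fun h v

variable [IsManifold (𝓡 n) ∞ M] (D : AffineConnection n M)

namespace AffineConnection

lemma cov_sum {ι : Type*} (A : Finset ι) (Y : ι → Π x : M, TangentSpace (𝓡 n) x) (x : M)
    (hY : ∀ i, MDifferentiableAt (𝓡 n) (𝓡 n).tangent
      (fun y => (⟨y, Y i y⟩ : TangentBundle (𝓡 n) M)) x) :
    D.cov (fun y => ∑ i ∈ A, Y i y) x = ∑ i ∈ A, D.cov (Y i) x ∧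
    MDifferentiableAt (𝓡 n) (𝓡 n).tangent
      (fun y => (⟨y, ∑ i ∈ A, Y i y⟩ : TangentBundle (𝓡 n) M)) x := by
  classical
  have hs : ∀ A : Finset ι, MDifferentiableAt (𝓡 n) (𝓡 n).tangent
      (fun y => (⟨y, ∑ i ∈ A, Y i y⟩ : TangentBundle (𝓡 n) M)) x := fun A =>
    MDifferentiableAt.sum_section fun i _ => hY i
  refine ⟨?_, hs A⟩
  induction A using Finset.induction_on with
  | empty =>
    simp only [Finset.sum_empty]
    exact congrFun D.cov.zero x
  | insert a A ha ih =>
    rw [Finset.sum_insert ha, ← ih, ← D.cov.isCovariantDerivativeOnUniv.add (hY a) (hs A)]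
    congr 1
    ext1 y
    exact Finset.sum_insert ha

/-- A covariant derivative in terms of the components of the vector field. -/
lemma cov_eq (Y : Π x : M, TangentSpace (𝓡 n) x) (x : M)
    (hY : MDifferentiableAt (𝓡 n) (𝓡 n).tangent
      (fun y => (⟨y, Y y⟩ : TangentBundle (𝓡 n) M)) x) (v : TangentSpace (𝓡 n) x) :
    MDifferentiableAt (𝓡 n) 𝓘(ℝ, EuclideanSpace ℝ (Fin n)) (fun y => chartCoord x y (Y y)) x ∧
    D.cov Y x v = chartVec x x (mvfderiv (𝓡 n) (fun y => chartCoord x y (Y y)) x v)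
      + D.gam x v (Y x) := by
  have hx := mem_chartDomain (n := n) x
  have hc : MDifferentiableAt (𝓡 n) 𝓘(ℝ, EuclideanSpace ℝ (Fin n))
      (fun y => chartCoord x y (Y y)) x := by
    refine ((mdifferentiableAt_section _ _).1 hY).congr_of_eventuallyEq ?_
    filter_upwards [(isOpen_chartDomain x).mem_nhds hx] with y hy
    exact chartCoord_apply hy _
  refine ⟨hc, ?_⟩
  let c : Fin n → M → ℝ := fun i y => chartCoord x y (Y y) i
  let p : Fin n → EuclideanSpace ℝ (Fin n) →L[ℝ] ℝ := fun i => EuclideanSpace.proj i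
  have hci : ∀ i, MDifferentiableAt (𝓡 n) 𝓘(ℝ) (c i) x := fun i =>
    (p i).mdifferentiableAt.comp x hc
  have hcd : ∀ i, mvfderiv (𝓡 n) (c i) x v
      = (mvfderiv (𝓡 n) (fun y => chartCoord x y (Y y)) x v) i := by
    exact fun i => mvfderiv_clm_comp (p i) hc v
  let F : Fin n → Π y : M, TangentSpace (𝓡 n) y :=
    fun i y => chartVec x y (EuclideanSpace.single i 1)
  have hF : ∀ i, MDifferentiableAt (𝓡 n) (𝓡 n).tangent
      (fun y => (⟨y, F i y⟩ : TangentBundle (𝓡 n) M)) x := fun i =>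
    (contMDiffAt_chartVec hx _).mdifferentiableAt (by simp)
  have hcF : ∀ i, MDifferentiableAt (𝓡 n) (𝓡 n).tangent
      (fun y => (⟨y, (c i • F i) y⟩ : TangentBundle (𝓡 n) M)) x := fun i =>
    (hci i).smul_section (hF i)
  -- The expansion in the coordinate frame holds only inside the chart; locality of `cov` makes this
  -- sufficient, and the Leibniz rule is then applied term by term.
  have hYe : ∀ᶠ y in 𝓝 x, Y y = ∑ i, (c i • F i) y := by
    filter_upwards [(isOpen_chartDomain x).mem_nhds hx] with y hy
    exact (sum_chartCoord_smul hy _).symm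
  obtain ⟨h1, h2⟩ := D.cov_sum Finset.univ (fun i => c i • F i) x hcF
  rw [D.cov.isCovariantDerivativeOnUniv.congr_of_eventuallyEq hY h2 Filter.univ_mem hYe, h1]
  have h3 : ∀ i, D.cov (c i • F i) x v = c i x • D.gam x v (F i x)
      + mvfderiv (𝓡 n) (c i) x v • F i x := by
    intro i
    rw [D.cov.isCovariantDerivativeOnUniv.leibniz (hF i) (hci i)]
    have : D.gam x v (F i x) = D.cov (F i) x v := by
      change D.cov (extendVec (F i x)) x v = _
      congr 2
      ext1 y
      exact extendVec_chartVec _ _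
    rw [this]
    rfl
  rw [sum_apply]
  simp only [h3, Finset.sum_add_distrib]
  rw [add_comm]
  congr 1
  · rw [← sum_chartCoord_smul hx (chartVec x x _)]
    refine Finset.sum_congr rfl fun i _ => ?_
    rw [chartCoord_chartVec hx, hcd]
  · simp only [← map_smul, ← map_sum]
    congr 1
    exact sum_chartCoord_smul hx _

end AffineConnection

end ProjectiveTractor

end

/-! ### Vector fields along a curve, computed in a fixed chart. -/

noncomputable section

namespace ProjectiveTractor

variable {n : ℕ} {M : Type*} [TopologicalSpace M] [ChartedSpace (EuclideanSpace ℝ (Fin n)) M]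
  {γ : ℝ → M} {t : ℝ} {x₀ : M}

lemma eventually_mem_chartDomain (hγ : ContinuousAt γ t) (ht : γ t ∈ chartDomain (n := n) x₀) :
    ∀ᶠ s in 𝓝 t, γ s ∈ chartDomain (n := n) x₀ :=
  hγ.eventually ((isOpen_chartDomain x₀).mem_nhds ht)

variable [IsManifold (𝓡 n) ∞ M]

lemma mdifferentiableAt_extChartAt_apply {x : M} (hx : x ∈ chartDomain (n := n) x₀)
    (v : TangentSpace (𝓡 n) x) :
    MDifferentiableAt (𝓡 n) 𝓘(ℝ, EuclideanSpace ℝ (Fin n)) (extChartAt (𝓡 n) x₀) x ∧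
    mvfderiv (𝓡 n) (extChartAt (𝓡 n) x₀) x v = chartCoord x₀ x v := by
  refine ⟨mdifferentiableAt_extChartAt hx, ?_⟩
  have := DFunLike.congr_fun (TangentBundle.continuousLinearMapAt_trivializationAt (𝕜 := ℝ)
      (I := 𝓡 n) hx) v
  exact this.symm

lemma chartCoord_velocity (hγ : MDifferentiableAt 𝓘(ℝ) (𝓡 n) γ t)
    (ht : γ t ∈ chartDomain (n := n) x₀) :
    chartCoord x₀ (γ t) (velocity γ t) = deriv (fun s => extChartAt (𝓡 n) x₀ (γ s)) t := by
  obtain ⟨h1, h2⟩ := mdifferentiableAt_extChartAt_apply ht (velocity γ t)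
  rw [(hasDerivAt_comp_curve h1 hγ).deriv, h2]

/-- In a fixed chart the components of the velocity are the derivatives of the coordinates of `γ`
(`chartCoord_velocity`). -/
lemma contDiffAt_chartCoord_velocity {J : Set ℝ} (hJ : IsOpen J)
    (hγ : ContMDiffOn 𝓘(ℝ) (𝓡 n) ∞ γ J) (htJ : t ∈ J) (ht : γ t ∈ chartDomain (n := n) x₀) :
    ContDiffAt ℝ ∞ (fun s => chartCoord x₀ (γ s) (velocity (n := n) γ s)) t := by
  have hγt := hγ.contMDiffAt (hJ.mem_nhds htJ)
  have hs : ContDiffAt ℝ ∞ (fun s => extChartAt (𝓡 n) x₀ (γ s)) t :=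
    ((contMDiffAt_extChartAt' ht).comp t hγt).contDiffAt
  have hd : ContDiffAt ℝ ∞ (deriv fun s => extChartAt (𝓡 n) x₀ (γ s)) t := by
    have := (hs.fderiv_right (m := ∞) (by simp)).clm_apply (contDiffAt_const (c := (1 : ℝ)))
    exact this
  refine hd.congr_of_eventuallyEq ?_
  filter_upwards [eventually_mem_chartDomain hγt.continuousAt ht, hJ.mem_nhds htJ] with s hs hsJ
  exact chartCoord_velocity ((hγ.contMDiffAt (hJ.mem_nhds hsJ)).mdifferentiableAt (by simp)) hs

lemma contMDiffAt_velocity {J : Set ℝ} (hJ : IsOpen J)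
    (hγ : ContMDiffOn 𝓘(ℝ) (𝓡 n) ∞ γ J) (htJ : t ∈ J) :
    ContMDiffAt 𝓘(ℝ) (𝓡 n).tangent ∞
      (fun s => (⟨γ s, velocity γ s⟩ : TangentBundle (𝓡 n) M)) t := by
  have hγt := hγ.contMDiffAt (hJ.mem_nhds htJ)
  have ht := mem_chartDomain (n := n) (γ t)
  refine ((trivializationAt (EuclideanSpace ℝ (Fin n)) (TangentSpace (𝓡 n)) (γ t)).contMDiffAt_iff
    (n := ∞) (f := fun s => (⟨γ s, velocity γ s⟩ : TangentBundle (𝓡 n) M)) ht).2 ⟨hγt, ?_⟩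
  refine (contDiffAt_chartCoord_velocity hJ hγ htJ ht).contMDiffAt.congr_of_eventuallyEq ?_
  filter_upwards [eventually_mem_chartDomain hγt.continuousAt ht] with s hs
  exact (chartCoord_apply hs _).symm

lemma contDiffAt_chartCoord_of_contMDiffAt {V : (s : ℝ) → TangentSpace (𝓡 n) (γ s)}
    (hV : ContMDiffAt 𝓘(ℝ) (𝓡 n).tangent ∞ (fun s => (⟨γ s, V s⟩ : TangentBundle (𝓡 n) M)) t)
    (ht : γ t ∈ chartDomain (n := n) x₀) :
    ContDiffAt ℝ ∞ (fun s => chartCoord x₀ (γ s) (V s)) t := by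
  obtain ⟨h1, h2⟩ := ((trivializationAt (EuclideanSpace ℝ (Fin n)) (TangentSpace (𝓡 n))
    x₀).contMDiffAt_iff (n := ∞) (f := fun s => (⟨γ s, V s⟩ : TangentBundle (𝓡 n) M)) ht).1 hV
  refine h2.contDiffAt.congr_of_eventuallyEq ?_
  filter_upwards [eventually_mem_chartDomain h1.continuousAt ht] with s hs
  exact chartCoord_apply hs _

/-- A vector field with constant components in a chart agrees near a given point of the chart with
a global smooth vector field. -/
lemma exists_isSmoothVectorField_eq [T2Space M] {x : M} (hx : x ∈ chartDomain (n := n) x₀)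
    (w : EuclideanSpace ℝ (Fin n)) : ∃ Y : Π y : M, TangentSpace (𝓡 n) y,
      IsSmoothVectorField Y ∧ ∀ᶠ y in 𝓝 x, Y y = chartVec x₀ y w := by
  obtain ⟨f, -, hf⟩ := ((SmoothBumpFunction.nhds_basis_tsupport (I := 𝓡 n) x).mem_iff).1
    ((isOpen_chartDomain x₀).mem_nhds hx)
  refine ⟨fun y => f y • chartVec x₀ y w, fun y => ?_, ?_⟩
  · by_cases hy : y ∈ tsupport f
    · exact (f.contMDiff y).smul_section (contMDiffAt_chartVec (hf hy) w)
    · refine (contMDiffAt_zeroSection (n := ∞) (IB := 𝓡 n) ℝ (TangentSpace (𝓡 n) : M → Type _)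
        (F := EuclideanSpace ℝ (Fin n)) (x := y)).congr_of_eventuallyEq ?_
      filter_upwards [(isClosed_tsupport f).isOpen_compl.mem_nhds hy] with z hz
      rw [image_eq_zero_of_notMem_tsupport hz, zero_smul]
      rfl
  · filter_upwards [f.eventuallyEq_one] with y hy
    rw [hy, Pi.one_apply, one_smul]

namespace AffineConnection

variable (D : AffineConnection n M)

/-- This is `cov_eq` for the frame fields of the chart at `x₀`: the derivative along `γ` of the
transition matrix between two charts is the difference of the two connection forms. All changes of
chart below rest on it. -/
lemma hasDerivAt_chartCoord_chartVec (hγ : MDifferentiableAt 𝓘(ℝ) (𝓡 n) γ t)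
    (ht : γ t ∈ chartDomain (n := n) x₀) (w : EuclideanSpace ℝ (Fin n)) :
    HasDerivAt (fun s => chartCoord (γ t) (γ s) (chartVec x₀ (γ s) w))
      (chartCoord (γ t) (γ t) (D.cov (fun y => chartVec x₀ y w) (γ t) (velocity γ t)
        - D.gam (γ t) (velocity γ t) (chartVec x₀ (γ t) w))) t := by
  obtain ⟨h1, h2⟩ := D.cov_eq (fun y => chartVec x₀ y w) (γ t)
    ((contMDiffAt_chartVec ht w).mdifferentiableAt (by simp)) (velocity γ t)
  refine (hasDerivAt_comp_curve h1 hγ).congr_deriv ?_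
  rw [h2, add_sub_cancel_right, chartCoord_chartVec (mem_chartDomain _)]

/-- The covariant derivative along a curve in terms of the components of the vector field in an
arbitrary preferred chart. -/
lemma vectorDerivAlong_eq (hγ : MDifferentiableAt 𝓘(ℝ) (𝓡 n) γ t)
    (ht : γ t ∈ chartDomain (n := n) x₀) (V : (s : ℝ) → TangentSpace (𝓡 n) (γ s))
    (hV : DifferentiableAt ℝ (fun s => chartCoord x₀ (γ s) (V s)) t) :
    D.vectorDerivAlong γ V t = chartVec x₀ (γ t) (deriv (fun s => chartCoord x₀ (γ s) (V s)) t)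
      + ∑ i, chartCoord x₀ (γ t) (V t) i •
        D.cov (fun y => chartVec x₀ y (EuclideanSpace.single i 1)) (γ t) (velocity γ t) := by
  set c : ℝ → EuclideanSpace ℝ (Fin n) := fun s => chartCoord x₀ (γ s) (V s) with hc
  have htt := mem_chartDomain (n := n) (γ t)
  -- Expand `V` in the frame of the chart at `x₀` and differentiate in the chart at `γ t`. The
  -- derivative of the transition matrix contributes `-gam`, which cancels the Christoffel term in
  -- the definition of `vectorDerivAlong`.
  have hd : HasDerivAt (fun s => ∑ i, c s i • chartCoord (γ t) (γ s)
      (chartVec x₀ (γ s) (EuclideanSpace.single i 1)))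
      (∑ i, (c t i • chartCoord (γ t) (γ t) (D.cov (fun y => chartVec x₀ y
          (EuclideanSpace.single i 1)) (γ t) (velocity γ t)
        - D.gam (γ t) (velocity γ t) (chartVec x₀ (γ t) (EuclideanSpace.single i 1)))
        + deriv c t i • chartCoord (γ t) (γ t) (chartVec x₀ (γ t) (EuclideanSpace.single i 1)))) t := by
    refine HasDerivAt.fun_sum fun i _ => ?_
    have hci : HasDerivAt (fun s => c s i) (deriv c t i) t :=
      ((EuclideanSpace.proj i : EuclideanSpace ℝ (Fin n) →L[ℝ] ℝ).hasFDerivAt).comp_hasDerivAt t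
        hV.hasDerivAt
    exact hci.smul (D.hasDerivAt_chartCoord_chartVec hγ ht _)
  have he : (fun s => ((trivializationAt (EuclideanSpace ℝ (Fin n)) (TangentSpace (𝓡 n)) (γ t))
      ⟨γ s, V s⟩).2) =ᶠ[𝓝 t] (fun s => ∑ i, c s i • chartCoord (γ t) (γ s)
      (chartVec x₀ (γ s) (EuclideanSpace.single i 1))) := by
    filter_upwards [eventually_mem_chartDomain hγ.continuousAt ht,
      eventually_mem_chartDomain hγ.continuousAt htt] with s hs hs'
    rw [← chartCoord_apply hs', ← sum_chartCoord_smul hs (V s)]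
    simp only [map_sum, map_smul, hc]
  have h0 : D.vectorDerivAlong γ V t = chartVec (γ t) (γ t) (deriv (fun s =>
      ((trivializationAt (EuclideanSpace ℝ (Fin n)) (TangentSpace (𝓡 n)) (γ t)) ⟨γ s, V s⟩).2) t)
      + D.gam (γ t) (velocity γ t) (V t) := rfl
  rw [h0, he.deriv_eq, hd.deriv]
  simp only [← map_smul, ← map_add, ← map_sum, chartVec_chartCoord htt]
  conv_lhs => rw [← sum_chartCoord_smul ht (V t)]
  conv_rhs => rw [← sum_chartCoord_smul ht (chartVec x₀ (γ t) (deriv c t)), chartCoord_chartVec ht]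
  simp only [map_sum, map_smul, smul_sub, Finset.sum_add_distrib, Finset.sum_sub_distrib, hc]
  abel

/-- The trace of the connection form of the coordinate frame of the preferred chart at `x₀`. -/
def covTrace (x₀ x : M) (v : TangentSpace (𝓡 n) x) : ℝ :=
  ∑ i, chartCoord x₀ x (D.cov (fun y => chartVec x₀ y (EuclideanSpace.single i 1)) x v) i

/-- Smoothness of the connection is applied to global vector fields, so the frame field is first
replaced by a global field with the same germ at `γ t`. -/
lemma contDiffAt_chartCoord_cov [T2Space M] {J : Set ℝ} (hJ : IsOpen J)
    (hγ : ContMDiffOn 𝓘(ℝ) (𝓡 n) ∞ γ J) (htJ : t ∈ J) (ht : γ t ∈ chartDomain (n := n) x₀)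
    (w : EuclideanSpace ℝ (Fin n)) : ContDiffAt ℝ ∞
      (fun s => chartCoord x₀ (γ s) (D.cov (fun y => chartVec x₀ y w) (γ s) (velocity γ s))) t := by
  have hγt := hγ.contMDiffAt (hJ.mem_nhds htJ)
  obtain ⟨Y, hY, hYe⟩ := exists_isSmoothVectorField_eq ht w
  have hcov := (D.smooth.contMDiff.contMDiff (σ := Y) hY.contMDiffOn).contMDiffAt
    (x := γ t) Filter.univ_mem
  have h := (hcov.comp t hγt).clm_bundle_apply (contMDiffAt_velocity hJ hγ htJ)
  refine (contDiffAt_chartCoord_of_contMDiffAt h ht).congr_of_eventuallyEq ?_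
  -- At each nearby `γ s` the two fields must agree on a whole neighbourhood, since `cov` depends on
  -- germs; hence `eventually_nhds`.
  filter_upwards [hγt.continuousAt.eventually hYe.eventually_nhds,
    eventually_mem_chartDomain hγt.continuousAt ht] with s hs hs'
  rw [D.cov.isCovariantDerivativeOnUniv.congr_of_eventuallyEq
    ((hY (γ s)).mdifferentiableAt (by simp))
    ((contMDiffAt_chartVec hs' w).mdifferentiableAt (by simp)) Filter.univ_mem hs]

lemma contDiffAt_covTrace [T2Space M] {J : Set ℝ} (hJ : IsOpen J)
    (hγ : ContMDiffOn 𝓘(ℝ) (𝓡 n) ∞ γ J) (htJ : t ∈ J) (ht : γ t ∈ chartDomain (n := n) x₀) :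
    ContDiffAt ℝ ∞ (fun s => D.covTrace x₀ (γ s) (velocity γ s)) t :=
  ContDiffAt.sum fun i _ =>
    ((EuclideanSpace.proj i : EuclideanSpace ℝ (Fin n) →L[ℝ] ℝ).contDiff.contDiffAt).comp t
      (D.contDiffAt_chartCoord_cov hJ hγ htJ ht _)

end AffineConnection

end ProjectiveTractor

end

/-! ### Densities along a curve, computed in a fixed chart. -/

noncomputable section

namespace ProjectiveTractor

lemma contDiffAt_abs_rpow {u : ℝ → ℝ} {t p : ℝ} (hu : ContDiffAt ℝ ∞ u t) (h0 : u t ≠ 0) :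
    ContDiffAt ℝ ∞ (fun s => |u s| ^ p) t :=
  ((contDiffAt_abs h0).comp t hu).rpow_const_of_ne (abs_pos.2 h0).ne'

/-- The hypothesis is in logarithmic form, as Jacobi's formula delivers it; then the sign of `u`
drops out through `sign u * u = |u|`. -/
lemma hasDerivAt_abs_rpow {u : ℝ → ℝ} {t p u' : ℝ} (hu : HasDerivAt u (u t * u') t)
    (h0 : u t ≠ 0) : HasDerivAt (fun s => |u s| ^ p) (|u t| ^ p * (p * u')) t := by
  have h1 := ((hasDerivAt_abs h0).comp t hu).rpow_const (p := p) (Or.inl (abs_pos.2 h0).ne')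
  refine h1.congr_deriv ?_
  have h2 : (SignType.sign (u t) : ℝ) * u t = |u t| := sign_mul_self (u t)
  simp only [Function.comp_apply]
  rw [Real.rpow_sub_one (abs_pos.2 h0).ne', ← mul_assoc, h2]
  field_simp [(abs_pos.2 h0).ne']

variable {n : ℕ} {M : Type*} [TopologicalSpace M] [ChartedSpace (EuclideanSpace ℝ (Fin n)) M]
  [IsManifold (𝓡 n) ∞ M] {γ : ℝ → M} {t : ℝ} {w : ℝ}

section ChartDet

variable (n) in
/-- The determinant of the coordinate frame of the preferred chart at `x` with respect to that of
the preferred chart at `x'`. -/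
def chartDet (x x' y : M) : ℝ :=
  (EuclideanSpace.basisFun (Fin n) ℝ).toBasis.det
    (fun i => chartCoord x' y (chartVec x y (EuclideanSpace.single i 1)))

variable {x x' y : M}

lemma frameBasis_det (h : y ∈ chartDomain (n := n) x) (h' : y ∈ chartDomain (n := n) x') :
    (frameBasis h').det (frameBasis h) = chartDet n x x' y := by
  rw [frameBasis, Basis.det_map, LinearEquiv.symm_symm, chartDet]
  congr 1
  ext1 i
  rw [Function.comp_apply, coe_frameBasis, coordFrameField_apply]
  rfl

lemma chartDet_ne_zero (h : y ∈ chartDomain (n := n) x) (h' : y ∈ chartDomain (n := n) x') :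
    chartDet n x x' y ≠ 0 := by
  rw [← frameBasis_det h h']
  exact ((frameBasis h').isUnit_det _).ne_zero

lemma Density.apply_coordFrameField (φ : Density w n (TangentSpace (𝓡 n) y))
    (h : y ∈ chartDomain (n := n) x) (h' : y ∈ chartDomain (n := n) x') :
    φ.1 (coordFrameField x y) =
      |chartDet n x x' y| ^ (-w / ((n : ℝ) + 1)) * φ.1 (coordFrameField x' y) := by
  rw [← frameBasis_det h h', ← coe_frameBasis h, ← coe_frameBasis h']
  exact φ.apply_basis _ _

lemma contDiffAt_chartDet (hγ : ContMDiffAt 𝓘(ℝ) (𝓡 n) ∞ γ t)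
    (h : γ t ∈ chartDomain (n := n) x) (h' : γ t ∈ chartDomain (n := n) x') :
    ContDiffAt ℝ ∞ (fun s => chartDet n x x' (γ s)) t :=
  contDiffAt_det _ fun _ => contDiffAt_chartCoord_of_contMDiffAt
    ((contMDiffAt_chartVec h _).comp t hγ) h'

/-- The transition factor is a power of the absolute value of a nowhere vanishing smooth
determinant, so smoothness of a density may be tested in any chart around the point. -/
lemma contDiffAt_apply_coordFrameField (φ : (s : ℝ) → Density w n (TangentSpace (𝓡 n) (γ s)))
    (hγ : ContMDiffAt 𝓘(ℝ) (𝓡 n) ∞ γ t)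
    (h : γ t ∈ chartDomain (n := n) x) (h' : γ t ∈ chartDomain (n := n) x')
    (hφ : ContDiffAt ℝ ∞ (fun s => (φ s).1 (coordFrameField x (γ s))) t) :
    ContDiffAt ℝ ∞ (fun s => (φ s).1 (coordFrameField x' (γ s))) t := by
  refine ((contDiffAt_abs_rpow (p := -w / ((n : ℝ) + 1)) (contDiffAt_chartDet hγ h' h)
    (chartDet_ne_zero h' h)).mul hφ).congr_of_eventuallyEq ?_
  filter_upwards [eventually_mem_chartDomain hγ.continuousAt h,
    eventually_mem_chartDomain hγ.continuousAt h'] with s hs hs'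
  exact (φ s).apply_coordFrameField hs' hs

end ChartDet

lemma coeffAlong_self (φ : (s : ℝ) → Density w n (TangentSpace (𝓡 n) (γ s))) (t : ℝ) :
    coeffAlong γ φ t t = (φ t).1 (coordFrame (γ t)) := by
  rw [coeffAlong, coordFrameField_self]

namespace AffineConnection

variable (D : AffineConnection n M) {x₀ : M}

/-- Jacobi's formula for the transition matrix: its logarithmic derivative is the trace of the
difference of the two connection forms. The trace of `gam` does not depend on the basis and is
computed in the frame of the chart at `x₀`. -/
lemma hasDerivAt_chartDet (hγ : MDifferentiableAt 𝓘(ℝ) (𝓡 n) γ t)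
    (ht : γ t ∈ chartDomain (n := n) x₀) :
    HasDerivAt (fun s => chartDet n x₀ (γ t) (γ s)) (chartDet n x₀ (γ t) (γ t) *
      (D.covTrace x₀ (γ t) (velocity γ t) - D.traceGam (γ t) (velocity γ t))) t := by
  have htt := mem_chartDomain (n := n) (γ t)
  let e := (frameBasis ht).map (chartEquiv htt)
  have hfe : ∀ i, frameBasis ht i = chartVec x₀ (γ t) (EuclideanSpace.single i 1) := fun i => by
    rw [coe_frameBasis, coordFrameField_apply]
  have he : ∀ i, chartCoord (γ t) (γ t) (chartVec x₀ (γ t) (EuclideanSpace.single i 1)) = e i := by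
    intro i
    rw [← hfe]
    exact ((frameBasis ht).map_apply (chartEquiv htt) i).symm
  have h := hasDerivAt_det (EuclideanSpace.basisFun (Fin n) ℝ).toBasis e he
    (fun i => D.hasDerivAt_chartCoord_chartVec hγ ht (EuclideanSpace.single i 1))
  refine h.congr_deriv ?_
  have h1 : (EuclideanSpace.basisFun (Fin n) ℝ).toBasis.det e = chartDet n x₀ (γ t) (γ t) :=
    congrArg _ (funext fun i => (he i).symm)
  rw [h1]
  congr 1
  rw [traceGam, trace_eq_sum_repr (frameBasis ht), covTrace, ← Finset.sum_sub_distrib]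
  refine Finset.sum_congr rfl fun i _ => ?_
  have h2 : ∀ v : TangentSpace (𝓡 n) (γ t),
      e.repr (chartCoord (γ t) (γ t) v) i = (frameBasis ht).repr v i := by
    intro v
    simp only [e, Basis.map_repr, LinearEquiv.trans_apply]
    congr 2
    exact (chartEquiv htt).symm_apply_apply v
  rw [h2, map_sub, Finsupp.sub_apply, hfe, frameBasis_repr]

/-- The covariant derivative of a density along a curve in an arbitrary preferred chart. -/
lemma deriv_add_covTrace (φ : (s : ℝ) → Density w n (TangentSpace (𝓡 n) (γ s)))
    (hγ : MDifferentiableAt 𝓘(ℝ) (𝓡 n) γ t) (ht : γ t ∈ chartDomain (n := n) x₀)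
    (hφ : DifferentiableAt ℝ (coeffAlong γ φ t) t) :
    deriv (fun s => (φ s).1 (coordFrameField x₀ (γ s))) t
      + w / ((n : ℝ) + 1) * D.covTrace x₀ (γ t) (velocity γ t)
        * (φ t).1 (coordFrameField x₀ (γ t)) =
    |chartDet n x₀ (γ t) (γ t)| ^ (-w / ((n : ℝ) + 1)) * (deriv (coeffAlong γ φ t) t
      + w / ((n : ℝ) + 1) * D.traceGam (γ t) (velocity γ t) * coeffAlong γ φ t t) := by
  have htt := mem_chartDomain (n := n) (γ t)
  -- Differentiating the transition factor produces `-w/(n+1)` times the difference of `covTrace`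
  -- and `traceGam`, which exchanges one trace term for the other.
  have h := (hasDerivAt_abs_rpow (p := -w / ((n : ℝ) + 1)) (D.hasDerivAt_chartDet hγ ht)
    (chartDet_ne_zero ht htt)).mul hφ.hasDerivAt
  have he : (fun s => (φ s).1 (coordFrameField x₀ (γ s))) =ᶠ[𝓝 t]
      (fun s => |chartDet n x₀ (γ t) (γ s)| ^ (-w / ((n : ℝ) + 1)) * coeffAlong γ φ t s) := by
    filter_upwards [eventually_mem_chartDomain hγ.continuousAt ht,
      eventually_mem_chartDomain hγ.continuousAt htt] with s hs hs'
    exact (φ s).apply_coordFrameField hs hs'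
  rw [he.deriv_eq]
  refine (congrArg₂ (· + ·) h.deriv rfl).trans ?_
  rw [(φ t).apply_coordFrameField ht htt]
  simp only [coeffAlong]
  ring

/-- The logarithmic covariant derivative `φ⁻¹ ∇_{γ'} φ` of a density along a curve. -/
def logDerivAlong (γ : ℝ → M) (φ : (s : ℝ) → Density w n (TangentSpace (𝓡 n) (γ s)))
    (t : ℝ) : ℝ :=
  (deriv (coeffAlong γ φ t) t
      + w / ((n : ℝ) + 1) * D.traceGam (γ t) (velocity γ t) * coeffAlong γ φ t t)
    / coeffAlong γ φ t t

/-- By `deriv_add_covTrace`, passing to the fixed chart at `γ t` multiplies numerator and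
denominator by the same power of the transition determinant. The quotient is thus given near `t` by
a formula in that one chart, where every term is smooth. -/
lemma contDiffOn_logDerivAlong [T2Space M] {J : Set ℝ} (hJ : IsOpen J)
    (hγ : ContMDiffOn 𝓘(ℝ) (𝓡 n) ∞ γ J) (φ : (s : ℝ) → Density w n (TangentSpace (𝓡 n) (γ s)))
    (hφ : IsSmoothDensityAlong γ J φ) (h0 : ∀ s ∈ J, (φ s).1 (coordFrame (γ s)) ≠ 0) :
    ContDiffOn ℝ ∞ (D.logDerivAlong γ φ) J := by
  intro t ht
  have hγt := hγ.contMDiffAt (hJ.mem_nhds ht)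
  have htt := mem_chartDomain (n := n) (γ t)
  have hc : ContDiffAt ℝ ∞ (coeffAlong γ φ t) t := hφ t ht
  have hd : ContDiffAt ℝ ∞ (deriv (coeffAlong γ φ t)) t := by
    have := (hc.fderiv_right (m := ∞) (by simp)).clm_apply (contDiffAt_const (c := (1 : ℝ)))
    exact this
  have hne : coeffAlong γ φ t t ≠ 0 := by
    rw [coeffAlong_self]
    exact h0 t ht
  have h1 : ContDiffAt ℝ ∞ (fun s => (deriv (coeffAlong γ φ t) s
      + w / ((n : ℝ) + 1) * D.covTrace (γ t) (γ s) (velocity γ s) * coeffAlong γ φ t s)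
      / coeffAlong γ φ t s) t :=
    (hd.add ((contDiffAt_const.mul (D.contDiffAt_covTrace hJ hγ ht htt)).mul hc)).div hc hne
  refine ContDiffAt.contDiffWithinAt (h1.congr_of_eventuallyEq ?_)
  filter_upwards [eventually_mem_chartDomain hγt.continuousAt htt, hJ.mem_nhds ht] with s hs hsJ
  have hss := mem_chartDomain (n := n) (γ s)
  have h2 := D.deriv_add_covTrace φ ((hγ.contMDiffAt (hJ.mem_nhds hsJ)).mdifferentiableAt (by simp))
    hs ((hφ s hsJ).differentiableAt (by simp))
  have h3 := (φ s).apply_coordFrameField hs hss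
  have hp : |chartDet n (γ t) (γ s) (γ s)| ^ (-w / ((n : ℝ) + 1)) ≠ 0 :=
    (Real.rpow_pos_of_pos (abs_pos.2 (chartDet_ne_zero hs hss)) _).ne'
  rw [logDerivAlong]
  change _ = (deriv (fun s => (φ s).1 (coordFrameField (γ t) (γ s))) s
      + w / ((n : ℝ) + 1) * D.covTrace (γ t) (γ s) (velocity γ s)
        * (φ s).1 (coordFrameField (γ t) (γ s))) / (φ s).1 (coordFrameField (γ t) (γ s))
  rw [h2, h3, mul_div_mul_left _ _ hp]
  rfl

end AffineConnection

/-- There is a smooth positive density of any weight along a curve. -/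
lemma exists_pos_density (w : ℝ) {J : Set ℝ} (hJ : IsOpen J)
    (hγ : ContMDiffOn 𝓘(ℝ) (𝓡 n) ∞ γ J) :
    ∃ ρ : (s : ℝ) → Density w n (TangentSpace (𝓡 n) (γ s)),
      IsSmoothDensityAlong γ J ρ ∧ ∀ s ∈ J, 0 < (ρ s).1 (coordFrame (γ s)) := by
  classical
  let J' : TopologicalSpace.Opens ℝ := ⟨J, hJ⟩
  have hlc : LocallyCompactSpace J' := J'.isOpen.locallyCompactSpace
  have hγc : ContinuousOn γ J := hγ.continuousOn
  -- The partition of unity lives on `J` as an open submanifold of the line, because `γ` is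
  -- controlled only on `J`.
  obtain ⟨f, hf⟩ := SmoothPartitionOfUnity.exists_isSubordinate 𝓘(ℝ) (M := J') (s := univ)
    isClosed_univ (fun i : J' => {s : J' | γ s ∈ chartDomain (n := n) (γ i)})
    (fun i => (isOpen_chartDomain (γ i)).preimage hγc.domRestrict)
    (fun s _ => mem_iUnion.2 ⟨s, mem_chartDomain (n := n) (γ s)⟩)
  let p := -w / ((n : ℝ) + 1)
  have hfs : ∀ (i s : J'), f i s ≠ 0 → γ s ∈ chartDomain (n := n) (γ i) := fun i s hs =>
    hf i (subset_tsupport _ hs)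
  -- The density is `∑ f_i ρ_i`, where `ρ_i` takes the value `1` on the frame of the chart at `γ i`;
  -- `c a s` is its coefficient at `s` in the chart at `γ a`. Below, `ρ s` is defined by its value
  -- in the frame at `γ s` itself, and `hρ` recovers the coefficient in every other chart.
  let c : ℝ → J' → ℝ := fun a s => ∑ᶠ i : J', f i s • |chartDet n (γ a) (γ i) (γ s)| ^ p
  let ρ : (s : ℝ) → Density w n (TangentSpace (𝓡 n) (γ s)) := fun s =>
    if hs : s ∈ J then densityOfValue w (coordFrame (γ s)) (c s ⟨s, hs⟩) else 0
  have hρ : ∀ (a : ℝ) (s : J'), γ s ∈ chartDomain (n := n) (γ a) →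
      (ρ s).1 (coordFrameField (γ a) (γ s)) = c a s := by
    intro a s has
    have hss := mem_chartDomain (n := n) (γ s)
    have hρs : ρ s = densityOfValue w (coordFrame (γ s)) (c s s) := dif_pos s.2
    rw [(ρ s).apply_coordFrameField has hss, coordFrameField_self, hρs,
      densityOfValue_apply_self, mul_finsum]
    refine finsum_congr fun i => ?_
    rcases eq_or_ne (f i s) 0 with h0 | h0
    · simp [h0]
    · have his := hfs i s h0
      have h1 : ∀ b : M, ∀ hb : γ s ∈ chartDomain (n := n) b,
          (densityOfValue w (frameBasis his) 1).1 (coordFrameField b (γ s))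
            = |chartDet n b (γ i) (γ s)| ^ p := by
        intro b hb
        rw [← coe_frameBasis hb, densityOfValue_apply, frameBasis_det hb his, mul_one]
      have h2 := (densityOfValue w (frameBasis his) 1).apply_coordFrameField has hss
      rw [h1 _ has, h1 _ hss] at h2
      simp only [smul_eq_mul]
      rw [h2]
      ring
  refine ⟨ρ, fun t ht => ?_, fun t ht => ?_⟩
  · have hγt := hγ.contMDiffAt (hJ.mem_nhds ht)
    have htt := mem_chartDomain (n := n) (γ t)
    have h1 : ContMDiffAt 𝓘(ℝ) 𝓘(ℝ) ∞ (c t) (⟨t, ht⟩ : J') := by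
      refine f.contMDiffAt_finsum fun i hi => ?_
      have h2 : ContDiffAt ℝ ∞ (fun s => |chartDet n (γ t) (γ i) (γ s)| ^ p) t :=
        contDiffAt_abs_rpow (contDiffAt_chartDet hγt htt (hf i hi))
          (chartDet_ne_zero htt (hf i hi))
      exact (contMDiffAt_subtype_iff (x := (⟨t, ht⟩ : J'))).2 h2.contMDiffAt
    have h3 : ContMDiffAt 𝓘(ℝ) 𝓘(ℝ) ∞ (fun s : J' => coeffAlong γ ρ t s) (⟨t, ht⟩ : J') := by
      refine h1.congr_of_eventuallyEq ?_
      have : ∀ᶠ s : J' in 𝓝 ⟨t, ht⟩, γ s ∈ chartDomain (n := n) (γ t) :=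
        continuous_subtype_val.continuousAt.eventually
          (eventually_mem_chartDomain hγt.continuousAt htt)
      filter_upwards [this] with s hs
      exact hρ t s hs
    exact (contMDiffAt_subtype_iff.1 h3).contDiffAt
  · have h := hρ t ⟨t, ht⟩ (mem_chartDomain (n := n) (γ t))
    rw [coordFrameField_self] at h
    rw [h]
    obtain ⟨i, hi⟩ := f.exists_pos_of_mem (mem_univ (⟨t, ht⟩ : J'))
    refine finsum_pos (fun j => mul_nonneg (f.nonneg j _) (by positivity)) ⟨i, ?_⟩ ?_
    · exact mul_pos hi (Real.rpow_pos_of_pos (abs_pos.2 (chartDet_ne_zero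
        (mem_chartDomain (n := n) (γ t)) (hfs i _ hi.ne'))) _)
    · refine (f.locallyFinite.point_finite ⟨t, ht⟩).subset fun j hj => ?_
      exact left_ne_zero_of_mul hj

end ProjectiveTractor

end

/-! ### Two-tractors, linearity of the Schouten tensor, derivatives of cotractor fields. -/

noncomputable section

namespace ProjectiveTractor

/-- The exterior product of two linear forms. -/
def wedgeForm {V : Type*} [AddCommGroup V] [Module ℝ V] (f g : V →ₗ[ℝ] ℝ) : V [⋀^Fin 2]→ₗ[ℝ] ℝ :=
  Matrix.detRowAlternating.compLinearMap (LinearMap.pi ![f, g])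

lemma wedgeForm_apply {V : Type*} [AddCommGroup V] [Module ℝ V] (f g : V →ₗ[ℝ] ℝ) (a b : V) :
    wedgeForm f g ![a, b] = f a * g b - f b * g a := by
  refine (Matrix.det_fin_two (Matrix.of fun i => LinearMap.pi ![f, g] (![a, b] i))).trans ?_
  simp [mul_comm (g a)]

lemma alternating_swap {V : Type*} [AddCommGroup V] [Module ℝ V] (S : V [⋀^Fin 2]→ₗ[ℝ] ℝ)
    (a b : V) : S ![a, b] = -S ![b, a] := by
  have h := S.map_swap ![b, a] (i := 0) (j := 1) (by decide)
  rw [← h]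
  congr 1
  ext i
  fin_cases i <;> rfl

lemma alternating_ext {V : Type*} [AddCommGroup V] [Module ℝ V] {S S' : V [⋀^Fin 2]→ₗ[ℝ] ℝ}
    (h : ∀ a b, S ![a, b] = S' ![a, b]) : S = S' := by
  refine AlternatingMap.ext fun v => ?_
  have hv : v = ![v 0, v 1] := by
    ext i
    fin_cases i <;> rfl
  rw [hv]
  exact h _ _

variable {n : ℕ} {M : Type*} [TopologicalSpace M] [ChartedSpace (EuclideanSpace ℝ (Fin n)) M]
  [IsManifold (𝓡 n) ∞ M] {γ : ℝ → M} {t : ℝ} {J : Set ℝ}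

/-- The value of `X(α)` on the coordinate frame. -/
def xval (x : M) : Cotractor n x →ₗ[ℝ] ℝ :=
  Density.eval 1 (coordFrame (n := n) x) ∘ₗ canonicalX x

namespace AffineConnection

variable (D : AffineConnection n M)

/-- The value of `μ(v)` on the coordinate frame, where `μ` is the second component of the
cotractor `α`. -/
def mval (x : M) (v : TangentSpace (𝓡 n) x) : Cotractor n x →ₗ[ℝ] ℝ :=
  Density.eval 1 (coordFrame (n := n) x) ∘ₗ (D.splitting x).flip v

lemma mval_apply (x : M) (v : TangentSpace (𝓡 n) x) (α : Cotractor n x) :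
    D.mval x v α = (D.splitting x α v).1 (coordFrame x) := rfl

/-- The second component of a cotractor as a linear form. -/
def mform (x : M) (α : Cotractor n x) : TangentSpace (𝓡 n) x →ₗ[ℝ] ℝ :=
  Density.eval 1 (coordFrame (n := n) x) ∘ₗ D.splitting x α

lemma mform_apply (x : M) (v : TangentSpace (𝓡 n) x) (α : Cotractor n x) :
    D.mform x α v = D.mval x v α := rfl

lemma exists_cotractor_val (x : M) (r : ℝ) (l : TangentSpace (𝓡 n) x →ₗ[ℝ] ℝ) :
    ∃ α : Cotractor n x, xval x α = r ∧ ∀ v, D.mval x v α = l v := by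
  obtain ⟨α, h1, h2⟩ := D.exists_cotractor x (densityOfValue 1 (coordFrame x) r)
    (densityOfValue 1 (coordFrame x) ∘ₗ l)
  refine ⟨α, ?_, fun v => ?_⟩
  · change (canonicalX x α).1 (coordFrame x) = r
    rw [h1]
    exact densityOfValue_apply_self _ _
  · rw [mval_apply, h2]
    exact densityOfValue_apply_self _ _

/-- Differentiability of the inner field is what makes the outer derivative in `∇_U ∇_V W` additive.
A global field with the same germ as the frame field is used again. -/
lemma contMDiffAt_cov_extendVec [T2Space M] (x : M) (v w : TangentSpace (𝓡 n) x) :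
    ContMDiffAt (𝓡 n) (𝓡 n).tangent ∞ (fun y =>
      (⟨y, D.cov (extendVec w) y (extendVec v y)⟩ : TangentBundle (𝓡 n) M)) x := by
  have hx := mem_chartDomain (n := n) x
  obtain ⟨Y, hY, hYe⟩ := exists_isSmoothVectorField_eq hx (chartCoord x x w)
  have hcov := (D.smooth.contMDiff.contMDiff (σ := Y) hY.contMDiffOn).contMDiffAt
    (x := x) Filter.univ_mem
  refine (hcov.clm_bundle_apply (contMDiffAt_chartVec hx (chartCoord x x v))).congr_of_eventuallyEq
    ?_
  filter_upwards [hYe.eventually_nhds, (isOpen_chartDomain x).mem_nhds hx] with y hy hy'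
  have := D.cov.isCovariantDerivativeOnUniv.congr_of_eventuallyEq
    ((hY y).mdifferentiableAt (by simp))
    ((contMDiffAt_chartVec hy' (chartCoord x x w)).mdifferentiableAt (by simp)) Filter.univ_mem hy
  rw [this]
  rfl

lemma mdifferentiableAt_cov_extendVec [T2Space M] (x : M) (v w : TangentSpace (𝓡 n) x) :
    MDifferentiableAt (𝓡 n) (𝓡 n).tangent (fun y =>
      (⟨y, D.cov (extendVec w) y (extendVec v y)⟩ : TangentBundle (𝓡 n) M)) x :=
  (D.contMDiffAt_cov_extendVec x v w).mdifferentiableAt (by simp)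

/-- Needed on a neighbourhood and not only at `x`, because this expression is differentiated once
more in the curvature. -/
lemma cov_extendVec_add (x : M) (w w' : TangentSpace (𝓡 n) x) :
    ∀ᶠ y in 𝓝 x, D.cov (extendVec (w + w')) y = D.cov (extendVec w) y + D.cov (extendVec w') y := by
  filter_upwards [(isOpen_chartDomain (n := n) x).mem_nhds (mem_chartDomain x)] with y hy
  have h : ∀ u : TangentSpace (𝓡 n) x, MDifferentiableAt (𝓡 n) (𝓡 n).tangent
      (fun z => (⟨z, extendVec u z⟩ : TangentBundle (𝓡 n) M)) y := fun u =>
    (contMDiffAt_chartVec hy (chartCoord x x u)).mdifferentiableAt (by simp)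
  rw [extendVec_add]
  exact D.cov.isCovariantDerivativeOnUniv.add (h w) (h w')

lemma cov_extendVec_smul (x : M) (c : ℝ) (w : TangentSpace (𝓡 n) x) :
    ∀ᶠ y in 𝓝 x, D.cov (extendVec (c • w)) y = c • D.cov (extendVec w) y := by
  filter_upwards [(isOpen_chartDomain (n := n) x).mem_nhds (mem_chartDomain x)] with y hy
  have h : MDifferentiableAt (𝓡 n) (𝓡 n).tangent
      (fun z => (⟨z, extendVec w z⟩ : TangentBundle (𝓡 n) M)) y :=
    (contMDiffAt_chartVec hy (chartCoord x x w)).mdifferentiableAt (by simp)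
  rw [extendVec_smul]
  exact D.cov.isCovariantDerivativeOnUniv.smul_const c h

/-- The second covariant derivative `∇_U ∇_V W` is additive in `W` and in `V`. -/
lemma cov_cov_add [T2Space M] (x : M) (v v' w w' : TangentSpace (𝓡 n) x) :
    D.cov (fun y => D.cov (extendVec (w + w')) y (extendVec v y)) x =
      D.cov (fun y => D.cov (extendVec w) y (extendVec v y)) x +
        D.cov (fun y => D.cov (extendVec w') y (extendVec v y)) x ∧
    D.cov (fun y => D.cov (extendVec w) y (extendVec (v + v') y)) x =
      D.cov (fun y => D.cov (extendVec w) y (extendVec v y)) x +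
        D.cov (fun y => D.cov (extendVec w) y (extendVec v' y)) x := by
  constructor
  · rw [← D.cov.isCovariantDerivativeOnUniv.add (D.mdifferentiableAt_cov_extendVec x v w)
      (D.mdifferentiableAt_cov_extendVec x v w')]
    refine D.cov.isCovariantDerivativeOnUniv.congr_of_eventuallyEq
      (D.mdifferentiableAt_cov_extendVec x v (w + w'))
      (((D.contMDiffAt_cov_extendVec x v w).add_section
        (D.contMDiffAt_cov_extendVec x v w')).mdifferentiableAt (by simp)) Filter.univ_mem ?_
    filter_upwards [D.cov_extendVec_add x w w'] with y hy
    rw [hy]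
    rfl
  · rw [← D.cov.isCovariantDerivativeOnUniv.add (D.mdifferentiableAt_cov_extendVec x v w)
      (D.mdifferentiableAt_cov_extendVec x v' w)]
    congr 1
    ext1 y
    rw [extendVec_add, Pi.add_apply, map_add]
    rfl

/-- The second covariant derivative `∇_U ∇_V W` is homogeneous in `W` and in `V`. -/
lemma cov_cov_smul [T2Space M] (x : M) (c : ℝ) (v w : TangentSpace (𝓡 n) x) :
    D.cov (fun y => D.cov (extendVec (c • w)) y (extendVec v y)) x =
      c • D.cov (fun y => D.cov (extendVec w) y (extendVec v y)) x ∧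
    D.cov (fun y => D.cov (extendVec w) y (extendVec (c • v) y)) x =
      c • D.cov (fun y => D.cov (extendVec w) y (extendVec v y)) x := by
  constructor
  · rw [← D.cov.isCovariantDerivativeOnUniv.smul_const c (D.mdifferentiableAt_cov_extendVec x v w)]
    refine D.cov.isCovariantDerivativeOnUniv.congr_of_eventuallyEq
      (D.mdifferentiableAt_cov_extendVec x v (c • w))
      (mdifferentiableAt_const.smul_section
        (D.mdifferentiableAt_cov_extendVec x v w)) Filter.univ_mem ?_
    filter_upwards [D.cov_extendVec_smul x c w] with y hy
    rw [hy]
    rfl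
  · rw [← D.cov.isCovariantDerivativeOnUniv.smul_const c (D.mdifferentiableAt_cov_extendVec x v w)]
    congr 1
    ext1 y
    rw [extendVec_smul, Pi.smul_apply, map_smul]
    rfl

lemma curvature_add_right [T2Space M] (x : M) (u v w w' : TangentSpace (𝓡 n) x) :
    D.curvature x u v (w + w') = D.curvature x u v w + D.curvature x u v w' := by
  -- The `0` fills the slot of `v'`, which does not occur in the first identity.
  simp only [curvature, (D.cov_cov_add x _ 0 w w').1, (D.cov_extendVec_add x w w').self_of_nhds,
    add_apply]
  abel

lemma curvature_smul_right [T2Space M] (x : M) (c : ℝ) (u v w : TangentSpace (𝓡 n) x) :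
    D.curvature x u v (c • w) = c • D.curvature x u v w := by
  simp only [curvature, (D.cov_cov_smul x c _ w).1, (D.cov_extendVec_smul x c w).self_of_nhds,
    smul_apply, smul_sub]

lemma curvature_add_middle [T2Space M] (x : M) (u v v' w : TangentSpace (𝓡 n) x) :
    D.curvature x u (v + v') w = D.curvature x u v w + D.curvature x u v' w := by
  simp only [curvature, (D.cov_cov_add x v v' w 0).2, add_apply, map_add]
  rw [extendVec_add, VectorField.mlieBracket_add_right (mdifferentiableAt_extendVec v)
    (mdifferentiableAt_extendVec v'), map_add]
  abel

lemma curvature_smul_middle [T2Space M] (x : M) (c : ℝ) (u v w : TangentSpace (𝓡 n) x) :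
    D.curvature x u (c • v) w = c • D.curvature x u v w := by
  simp only [curvature, (D.cov_cov_smul x c v w).2, smul_apply, map_smul]
  rw [extendVec_smul, VectorField.mlieBracket_const_smul_right (mdifferentiableAt_extendVec v),
    map_smul, smul_sub, smul_sub]

/-- In `n Ric(v,w) + Ric(w,v)` the vector `w` enters the curvature in its last and in its middle
slot, so linearity in these two slots suffices. It is needed so that the second component of the
tractor derivative is a linear form. -/
lemma schouten_add [T2Space M] (x : M) (v w w' : TangentSpace (𝓡 n) x) :
    D.schouten x v (w + w') = D.schouten x v w + D.schouten x v w' := by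
  simp only [schouten, ricci, curvature_add_right, curvature_add_middle, map_add,
    Finset.sum_add_distrib]
  ring

lemma schouten_smul [T2Space M] (x : M) (c : ℝ) (v w : TangentSpace (𝓡 n) x) :
    D.schouten x v (c • w) = c * D.schouten x v w := by
  simp only [schouten, ricci, curvature_smul_right, curvature_smul_middle, map_smul, smul_eq_mul,
    ← Finset.mul_sum]
  ring

lemma differentiableAt_coeffAlong_splitting {α : (s : ℝ) → Cotractor n (γ s)}
    (hα : D.IsSmoothCotractorAlong γ J α) (ht : t ∈ J) (v : TangentSpace (𝓡 n) (γ t)) :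
    DifferentiableAt ℝ
      (coeffAlong γ (fun s => D.splitting (γ s) (α s) (extendVec v (γ s))) t) t :=
  (hα.2 t ht v).differentiableAt (by simp)

lemma formDerivAlong_apply (μ : (s : ℝ) → TangentSpace (𝓡 n) (γ s) →ₗ[ℝ]
      Density 1 n (TangentSpace (𝓡 n) (γ s))) (v : TangentSpace (𝓡 n) (γ t)) :
    (D.formDerivAlong γ μ t v).1 (coordFrame (γ t)) =
      deriv (coeffAlong γ (fun s => μ s (extendVec v (γ s))) t) t
        + 1 / ((n : ℝ) + 1) * D.traceGam (γ t) (velocity γ t) * (μ t v).1 (coordFrame (γ t))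
        - (μ t (D.gam (γ t) (velocity γ t) v)).1 (coordFrame (γ t)) := by
  rw [formDerivAlong, Density.sub_apply, densityDerivAlong, densityOfValue_apply_self,
    coeffAlong_self, extendVec_self]

/-- Every smooth cotractor field along a curve has a derivative. -/
lemma exists_isCotractorDeriv [T2Space M] {α : (s : ℝ) → Cotractor n (γ s)}
    (hα : D.IsSmoothCotractorAlong γ J α) (ht : t ∈ J) :
    ∃ α', D.IsCotractorDeriv γ α t α' := by
  have hc : ∀ v : TangentSpace (𝓡 n) (γ t), ∀ s,
      coeffAlong γ (fun s => D.splitting (γ s) (α s) (extendVec v (γ s))) t s =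
      (D.splitting (γ s) (α s) (extendVec v (γ s))).1 (coordFrameField (γ t) (γ s)) :=
    fun _ _ => rfl
  -- The formula for the second component of `∇_{γ'} α` is linear in `v`, so `exists_cotractor`
  -- applies. Parallelism is tested only on fields that have a derivative, so without this existence
  -- statement it would yield nothing.
  let μ : TangentSpace (𝓡 n) (γ t) →ₗ[ℝ] Density 1 n (TangentSpace (𝓡 n) (γ t)) :=
    { toFun := fun v => D.formDerivAlong γ (fun s => D.splitting (γ s) (α s)) t v
        + D.schouten (γ t) (velocity γ t) v • canonicalX (γ t) (α t)
      map_add' := fun v w => by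
        refine Density.ext_basis (coordFrame (γ t)) ?_
        have h : coeffAlong γ (fun s => D.splitting (γ s) (α s) (extendVec (v + w) (γ s))) t =
            coeffAlong γ (fun s => D.splitting (γ s) (α s) (extendVec v (γ s))) t +
            coeffAlong γ (fun s => D.splitting (γ s) (α s) (extendVec w (γ s))) t := by
          ext s
          rw [Pi.add_apply, hc, hc, hc, extendVec_add, Pi.add_apply, map_add, Density.add_apply]
        simp only [Density.add_apply, Density.smul_apply, formDerivAlong_apply, schouten_add, h,
          map_add, deriv_add (D.differentiableAt_coeffAlong_splitting hα ht v)
            (D.differentiableAt_coeffAlong_splitting hα ht w)]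
        ring
      map_smul' := fun c v => by
        refine Density.ext_basis (coordFrame (γ t)) ?_
        have h : coeffAlong γ (fun s => D.splitting (γ s) (α s) (extendVec (c • v) (γ s))) t =
            fun s => c * coeffAlong γ (fun s => D.splitting (γ s) (α s) (extendVec v (γ s))) t s := by
          ext s
          rw [hc, hc, extendVec_smul, Pi.smul_apply, map_smul, Density.smul_apply]
        simp only [Density.add_apply, Density.smul_apply, formDerivAlong_apply, schouten_smul, h,
          map_smul, deriv_const_mul c (D.differentiableAt_coeffAlong_splitting hα ht v),
          RingHom.id_apply]
        ring }
  obtain ⟨α', h1, h2⟩ := D.exists_cotractor (γ t) (D.densityDerivAlong γ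
    (fun s => canonicalX (γ s) (α s)) t - D.splitting (γ t) (α t) (velocity γ t)) μ
  exact ⟨α', h1, fun v => by rw [h2]; rfl⟩

end AffineConnection

end ProjectiveTractor

end

/-! ### The Leibniz rule for `ρ (σ μ'(γ') - σ' μ(γ'))`. -/

noncomputable section

namespace ProjectiveTractor

variable {n : ℕ} {M : Type*} [TopologicalSpace M] [ChartedSpace (EuclideanSpace ℝ (Fin n)) M]
  [IsManifold (𝓡 n) ∞ M] {γ : ℝ → M} {t : ℝ} {J : Set ℝ}

lemma velocity_eq_sum {s : ℝ} {x₀ : M} (hs : γ s ∈ chartDomain (n := n) x₀) :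
    velocity (n := n) γ s = ∑ i, chartCoord x₀ (γ s) (velocity γ s) i •
      extendVec (coordFrame x₀ i) (γ s) := by
  conv_lhs => rw [← sum_chartCoord_smul hs (velocity γ s)]
  refine Finset.sum_congr rfl fun i _ => ?_
  rw [← coordFrameField_apply]
  rfl

lemma differentiableAt_chartCoord_velocity (hJ : IsOpen J)
    (hγ : ContMDiffOn 𝓘(ℝ) (𝓡 n) ∞ γ J) (ht : t ∈ J) :
    DifferentiableAt ℝ (fun s => chartCoord (γ t) (γ s) (velocity (n := n) γ s)) t :=
  (contDiffAt_chartCoord_velocity hJ hγ ht (mem_chartDomain _)).differentiableAt (by simp)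

namespace AffineConnection

variable (D : AffineConnection n M)

lemma vectorDerivAlong_velocity (hJ : IsOpen J) (hγ : ContMDiffOn 𝓘(ℝ) (𝓡 n) ∞ γ J)
    (ht : t ∈ J) : D.vectorDerivAlong γ (velocity γ) t =
      chartVec (γ t) (γ t) (deriv (fun s => chartCoord (γ t) (γ s) (velocity γ s)) t)
        + D.gam (γ t) (velocity γ t) (velocity γ t) := by
  have hγt := hγ.contMDiffAt (hJ.mem_nhds ht)
  have he : (fun s => ((trivializationAt (EuclideanSpace ℝ (Fin n)) (TangentSpace (𝓡 n)) (γ t))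
      ⟨γ s, velocity γ s⟩).2) =ᶠ[𝓝 t] (fun s => chartCoord (γ t) (γ s) (velocity γ s)) := by
    filter_upwards [eventually_mem_chartDomain (n := n) hγt.continuousAt (mem_chartDomain _)]
      with s hs
    exact (chartCoord_apply hs _).symm
  rw [← he.deriv_eq]
  rfl

/-- Smoothness of a cotractor field is expressed by pairing `μ` with fields of constant
coefficients; expanding `γ'` in the coordinate frame reduces `μ(γ')` to that case. -/
lemma splitting_velocity_eventuallyEq (hγ : ContinuousAt γ t) (β : (s : ℝ) → Cotractor n (γ s)) :
    (fun s => (D.splitting (γ s) (β s) (velocity γ s)).1 (coordFrameField (γ t) (γ s)))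
      =ᶠ[𝓝 t] fun s => ∑ i, chartCoord (γ t) (γ s) (velocity γ s) i *
        coeffAlong γ (fun s => D.splitting (γ s) (β s)
          (extendVec (coordFrame (γ t) i) (γ s))) t s := by
  filter_upwards [eventually_mem_chartDomain (n := n) hγ (mem_chartDomain (γ t))] with s hs
  change (Density.eval 1 (coordFrameField (γ t) (γ s)) ∘ₗ D.splitting (γ s) (β s))
    (velocity γ s) = _
  conv_lhs => rw [velocity_eq_sum hs]
  simp only [map_sum, map_smul, smul_eq_mul]
  rfl

/-- The derivative of `μ(γ')` along `γ` for a cotractor field `β = (σ, μ)`. -/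
lemma hasDerivAt_splitting_velocity (hJ : IsOpen J) (hγ : ContMDiffOn 𝓘(ℝ) (𝓡 n) ∞ γ J)
    (ht : t ∈ J) {β : (s : ℝ) → Cotractor n (γ s)} (hβ : D.IsSmoothCotractorAlong γ J β)
    {β' : Cotractor n (γ t)} (h' : D.IsCotractorDeriv γ β t β') :
    HasDerivAt (fun s => (D.splitting (γ s) (β s) (velocity γ s)).1 (coordFrameField (γ t) (γ s)))
      (D.mval (γ t) (velocity γ t) β'
        + D.mval (γ t) (D.vectorDerivAlong γ (velocity γ) t) (β t)
        - 1 / ((n : ℝ) + 1) * D.traceGam (γ t) (velocity γ t) * D.mval (γ t) (velocity γ t) (β t)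
        - (∑ i, chartCoord (γ t) (γ t) (velocity γ t) i *
            D.schouten (γ t) (velocity γ t) (coordFrame (γ t) i)) * xval (γ t) (β t)) t := by
  have hγt := hγ.contMDiffAt (hJ.mem_nhds ht)
  have htt := mem_chartDomain (n := n) (γ t)
  set c : ℝ → EuclideanSpace ℝ (Fin n) := fun s => chartCoord (γ t) (γ s) (velocity γ s) with hc
  have hcd : DifferentiableAt ℝ c t := differentiableAt_chartCoord_velocity hJ hγ ht
  let m : Fin n → ℝ → ℝ := fun i =>
    coeffAlong γ (fun s => D.splitting (γ s) (β s) (extendVec (coordFrame (γ t) i) (γ s))) t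
  have hm : ∀ i, DifferentiableAt ℝ (m i) t := fun i =>
    D.differentiableAt_coeffAlong_splitting hβ ht _
  have he := D.splitting_velocity_eventuallyEq hγt.continuousAt β
  have hm0 : ∀ i, m i t = D.mform (γ t) (β t) (coordFrame (γ t) i) := fun i => by
    simp only [m]
    rw [coeffAlong_self, extendVec_self]
    rfl
  -- The defining equation of the tractor derivative `β'`, solved for the derivatives of the
  -- components of `μ`.
  have hmd : ∀ i, deriv (m i) t = D.mform (γ t) β' (coordFrame (γ t) i)
      - 1 / ((n : ℝ) + 1) * D.traceGam (γ t) (velocity γ t)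
        * D.mform (γ t) (β t) (coordFrame (γ t) i)
      + D.mform (γ t) (β t) (D.gam (γ t) (velocity γ t) (coordFrame (γ t) i))
      - D.schouten (γ t) (velocity γ t) (coordFrame (γ t) i) * xval (γ t) (β t) := fun i => by
    have h := congrArg (fun φ : Density 1 n (TangentSpace (𝓡 n) (γ t)) => φ.1 (coordFrame (γ t)))
      (h'.2 (coordFrame (γ t) i))
    simp only [Density.add_apply, Density.smul_apply, formDerivAlong_apply] at h
    change D.mform (γ t) β' (coordFrame (γ t) i) = deriv (m i) t + 1 / ((n : ℝ) + 1)
      * D.traceGam (γ t) (velocity γ t) * D.mform (γ t) (β t) (coordFrame (γ t) i)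
      - D.mform (γ t) (β t) (D.gam (γ t) (velocity γ t) (coordFrame (γ t) i))
      + D.schouten (γ t) (velocity γ t) (coordFrame (γ t) i) * xval (γ t) (β t) at h
    rw [h]
    ring
  have hd : HasDerivAt (fun s => ∑ i, c s i * m i s)
      (∑ i, (deriv c t i * m i t + c t i * deriv (m i) t)) t := by
    refine HasDerivAt.fun_sum fun i _ => ?_
    have hci : HasDerivAt (fun s => c s i) (deriv c t i) t :=
      ((EuclideanSpace.proj i : EuclideanSpace ℝ (Fin n) →L[ℝ] ℝ).hasFDerivAt).comp_hasDerivAt t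
        hcd.hasDerivAt
    exact hci.mul (hm i).hasDerivAt
  refine (hd.congr_of_eventuallyEq he).congr_deriv ?_
  have hv : ∀ v : TangentSpace (𝓡 n) (γ t),
      v = ∑ i, chartCoord (γ t) (γ t) v i • coordFrame (γ t) i := fun v => by
    conv_lhs => rw [← sum_chartCoord_smul htt v]
    refine Finset.sum_congr rfl fun i _ => ?_
    rw [← coordFrameField_apply, coordFrameField_self]
  have h1 : ∀ (l : TangentSpace (𝓡 n) (γ t) →ₗ[ℝ] ℝ), l (velocity γ t)
      = ∑ i, c t i * l (coordFrame (γ t) i) := fun l => by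
    conv_lhs => rw [hv (velocity γ t)]
    simp only [map_sum, map_smul, smul_eq_mul, hc]
  have h2 : ∀ (l : TangentSpace (𝓡 n) (γ t) →ₗ[ℝ] ℝ), l (chartVec (γ t) (γ t) (deriv c t))
      = ∑ i, deriv c t i * l (coordFrame (γ t) i) := fun l => by
    conv_lhs => rw [hv (chartVec (γ t) (γ t) (deriv c t)), chartCoord_chartVec htt]
    simp only [map_sum, map_smul, smul_eq_mul]
  rw [D.vectorDerivAlong_velocity hJ hγ ht]
  simp only [← mform_apply, map_add]
  rw [h2, h1 (D.mform (γ t) β'), h1 (D.mform (γ t) (β t))]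
  have h3 : D.mform (γ t) (β t) (D.gam (γ t) (velocity γ t) (velocity γ t))
      = ∑ i, c t i * D.mform (γ t) (β t) (D.gam (γ t) (velocity γ t) (coordFrame (γ t) i)) :=
    h1 (D.mform (γ t) (β t) ∘ₗ D.gam (γ t) (velocity γ t))
  rw [h3, Finset.mul_sum, Finset.sum_mul, ← Finset.sum_add_distrib, ← Finset.sum_add_distrib,
    ← Finset.sum_sub_distrib, ← Finset.sum_sub_distrib]
  · refine Finset.sum_congr rfl fun i _ => ?_
    rw [hm0, hmd]
    ring

/-- The derivative of `σ` along `γ` for a cotractor field `α = (σ, μ)`. -/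
lemma hasDerivAt_canonicalX (ht : t ∈ J) {α : (s : ℝ) → Cotractor n (γ s)}
    (hα : D.IsSmoothCotractorAlong γ J α)
    {α' : Cotractor n (γ t)} (h' : D.IsCotractorDeriv γ α t α') :
    HasDerivAt (coeffAlong γ (fun s => canonicalX (γ s) (α s)) t)
      (xval (γ t) α' - 1 / ((n : ℝ) + 1) * D.traceGam (γ t) (velocity γ t) * xval (γ t) (α t)
        + D.mval (γ t) (velocity γ t) (α t)) t := by
  refine ((hα.1 t ht).differentiableAt (by simp)).hasDerivAt.congr_deriv ?_
  have h := congrArg (fun φ : Density 1 n (TangentSpace (𝓡 n) (γ t)) => φ.1 (coordFrame (γ t))) h'.1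
  simp only [Density.sub_apply, densityDerivAlong, densityOfValue_apply_self, coeffAlong_self] at h
  change xval (γ t) α' = deriv (coeffAlong γ (fun s => canonicalX (γ s) (α s)) t) t
    + 1 / ((n : ℝ) + 1) * D.traceGam (γ t) (velocity γ t) * xval (γ t) (α t)
    - D.mval (γ t) (velocity γ t) (α t) at h
  rw [h]
  ring

/-- The `2`-tractor `2 X^{[α} W^{β]}_b u^b` with `u = ρ ⊗ γ'`. -/
def curveTractor (γ : ℝ → M) (ρ : (s : ℝ) → Density (-2) n (TangentSpace (𝓡 n) (γ s)))
    (t : ℝ) : TwoTractor n (γ t) :=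
  (ρ t).1 (coordFrame (γ t)) • wedgeForm (xval (γ t)) (D.mval (γ t) (velocity γ t))

lemma curveTractor_apply (ρ : (s : ℝ) → Density (-2) n (TangentSpace (𝓡 n) (γ s)))
    (α β : Cotractor n (γ t)) : D.curveTractor γ ρ t ![α, β] = (ρ t).1 (coordFrame (γ t)) *
      (xval (γ t) α * D.mval (γ t) (velocity γ t) β
        - xval (γ t) β * D.mval (γ t) (velocity γ t) α) := by
  rw [curveTractor, AlternatingMap.smul_apply, wedgeForm_apply, smul_eq_mul]

/-- The value of `curveTractor` computed in the coordinate frame of an arbitrary chart. -/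
lemma curveTractor_apply_chart (ρ : (s : ℝ) → Density (-2) n (TangentSpace (𝓡 n) (γ s)))
    {x₀ : M} (ht : γ t ∈ chartDomain (n := n) x₀) (α β : Cotractor n (γ t)) :
    D.curveTractor γ ρ t ![α, β] = (ρ t).1 (coordFrameField x₀ (γ t)) *
      ((canonicalX (γ t) α).1 (coordFrameField x₀ (γ t))
          * (D.splitting (γ t) β (velocity γ t)).1 (coordFrameField x₀ (γ t))
        - (canonicalX (γ t) β).1 (coordFrameField x₀ (γ t))
          * (D.splitting (γ t) α (velocity γ t)).1 (coordFrameField x₀ (γ t))) := by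
  rw [curveTractor_apply, mul_sub, mul_sub, ← coe_frameBasis ht]
  congr 1
  · exact Density.mul_mul_apply _ _ _ _ _
  · exact Density.mul_mul_apply _ _ _ _ _

/-- The Leibniz rule for `curveTractor`; the last term is the derivative of `ρ ⊗ γ'`. -/
lemma hasDerivAt_curveTractor (hJ : IsOpen J) (hγ : ContMDiffOn 𝓘(ℝ) (𝓡 n) ∞ γ J)
    (ht : t ∈ J) {ρ : (s : ℝ) → Density (-2) n (TangentSpace (𝓡 n) (γ s))}
    (hρ : DifferentiableAt ℝ (coeffAlong γ ρ t) t)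
    {α β : (s : ℝ) → Cotractor n (γ s)} (hα : D.IsSmoothCotractorAlong γ J α)
    (hβ : D.IsSmoothCotractorAlong γ J β) {α' β' : Cotractor n (γ t)}
    (hα' : D.IsCotractorDeriv γ α t α') (hβ' : D.IsCotractorDeriv γ β t β')
    (W : TangentSpace (𝓡 n) (γ t)) (hW : W = (deriv (coeffAlong γ ρ t) t + -2 / ((n : ℝ) + 1)
        * D.traceGam (γ t) (velocity γ t) * coeffAlong γ ρ t t) • velocity γ t
      + coeffAlong γ ρ t t • D.vectorDerivAlong γ (velocity γ) t) :
    HasDerivAt (fun s => D.curveTractor γ ρ s ![α s, β s])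
      (D.curveTractor γ ρ t ![α', β t] + D.curveTractor γ ρ t ![α t, β']
        + (xval (γ t) (α t) * D.mval (γ t) W (β t) - xval (γ t) (β t) * D.mval (γ t) W (α t))) t := by
  have hγt := hγ.contMDiffAt (hJ.mem_nhds ht)
  have htt := mem_chartDomain (n := n) (γ t)
  have h := hρ.hasDerivAt.mul (((D.hasDerivAt_canonicalX ht hα hα').mul
    (D.hasDerivAt_splitting_velocity hJ hγ ht hβ hβ')).sub
    ((D.hasDerivAt_canonicalX ht hβ hβ').mul
    (D.hasDerivAt_splitting_velocity hJ hγ ht hα hα')))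
  refine (h.congr_of_eventuallyEq ?_).congr_deriv ?_
  · filter_upwards [eventually_mem_chartDomain hγt.continuousAt htt] with s hs
    exact D.curveTractor_apply_chart ρ hs (α s) (β s)
  have hx : ∀ α : (s : ℝ) → Cotractor n (γ s),
      coeffAlong γ (fun s => canonicalX (γ s) (α s)) t t = xval (γ t) (α t) := fun α =>
    coeffAlong_self _ t
  have hm : ∀ α : (s : ℝ) → Cotractor n (γ s),
      (D.splitting (γ t) (α t) (velocity γ t)).1 (coordFrameField (γ t) (γ t))
        = D.mval (γ t) (velocity γ t) (α t) := fun α => by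
    rw [coordFrameField_self]
    rfl
  have hr : (ρ t).1 (coordFrame (γ t)) = coeffAlong γ ρ t t := (coeffAlong_self _ t).symm
  -- The terms `μ(γ') μ'(γ')` and the Schouten terms in `σ σ'` are symmetric in the two cotractors
  -- and cancel. The two trace terms of weight `1` together are the trace term of weight `-2` in
  -- `W`.
  simp only [Pi.sub_apply, Pi.mul_apply, hx, hm, curveTractor_apply, hr, hW, ← mform_apply, map_add,
    map_smul, smul_eq_mul]
  ring

end AffineConnection

end ProjectiveTractor

end

/-! ### The form of the incident parallel 2-tractors. -/

noncomputable section

namespace ProjectiveTractor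

variable {n : ℕ} {M : Type*} [TopologicalSpace M] [ChartedSpace (EuclideanSpace ℝ (Fin n)) M]
  [IsManifold (𝓡 n) ∞ M] {γ : ℝ → M} {t : ℝ} {J : Set ℝ}

namespace AffineConnection

variable (D : AffineConnection n M)

/-- Cotractor fields along a curve whose components in a chart are locally constant. -/
lemma exists_cotractor_field (hJ : IsOpen J) (hγ : ContMDiffOn 𝓘(ℝ) (𝓡 n) ∞ γ J) (ht : t ∈ J)
    (r : ℝ) (l : EuclideanSpace ℝ (Fin n) →ₗ[ℝ] ℝ) :
    ∃ α : (s : ℝ) → Cotractor n (γ s), D.IsSmoothCotractorAlong γ J α ∧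
      (r = 0 → ∀ s, canonicalX (γ s) (α s) = 0) ∧
      ∀ᶠ s in 𝓝 t, (canonicalX (γ s) (α s)).1 (coordFrameField (γ t) (γ s)) = r ∧
        ∀ v, (D.splitting (γ s) (α s) v).1 (coordFrameField (γ t) (γ s))
          = l (chartCoord (γ t) (γ s) v) := by
  classical
  have htt := mem_chartDomain (n := n) (γ t)
  have hγt := hγ.contMDiffAt (hJ.mem_nhds ht)
  have hU : ∀ᶠ s in 𝓝 t, s ∈ J ∧ γ s ∈ chartDomain (n := n) (γ t) :=
    (hJ.eventually_mem ht).and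
      (eventually_mem_chartDomain hγt.continuousAt htt)
  -- Multiplying the constant components by `χ`, supported in the part of `J` that `γ` maps into the
  -- chart, makes the extension by zero smooth on all of `J`.
  obtain ⟨χ, -, hχ⟩ := ((SmoothBumpFunction.nhds_basis_tsupport (I := 𝓘(ℝ)) t).mem_iff).1 hU
  have hχs : ContDiff ℝ ∞ χ := χ.contMDiff.contDiff
  choose F hF using fun (s : ℝ) (hs : γ s ∈ chartDomain (n := n) (γ t)) =>
    D.exists_cotractor (γ s) (densityOfValue 1 (frameBasis hs) (χ s * r))
      (densityOfValue 1 (frameBasis hs) ∘ₗ (χ s • l ∘ₗ chartCoord (γ t) (γ s)))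
  let α : (s : ℝ) → Cotractor n (γ s) := fun s =>
    if hs : γ s ∈ chartDomain (n := n) (γ t) then F s hs else 0
  have hα : ∀ s, ∀ hs : γ s ∈ chartDomain (n := n) (γ t), α s = F s hs := fun s hs => dif_pos hs
  have hα0 : ∀ s, ∀ hs : γ s ∉ chartDomain (n := n) (γ t), α s = 0 := fun s hs => dif_neg hs
  have hX : ∀ s, γ s ∈ chartDomain (n := n) (γ t) →
      (canonicalX (γ s) (α s)).1 (coordFrameField (γ t) (γ s)) = χ s * r := fun s hs => by
    rw [hα s hs, (hF s hs).1, ← coe_frameBasis hs]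
    exact densityOfValue_apply_self _ _
  have hμ : ∀ s, γ s ∈ chartDomain (n := n) (γ t) → ∀ v,
      (D.splitting (γ s) (α s) v).1 (coordFrameField (γ t) (γ s))
        = χ s * l (chartCoord (γ t) (γ s) v) := fun s hs v => by
    rw [hα s hs, (hF s hs).2, ← coe_frameBasis hs]
    exact densityOfValue_apply_self _ _
  have hzero : ∀ s, χ s = 0 → canonicalX (γ s) (α s) = 0 ∧ D.splitting (γ s) (α s) = 0 := by
    intro s hs0
    by_cases hs : γ s ∈ chartDomain (n := n) (γ t)
    · rw [hα s hs, (hF s hs).1, (hF s hs).2, hs0]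
      simp
    · rw [hα0 s hs]
      simp
  refine ⟨α, ⟨fun t₁ ht₁ => ?_, fun t₁ ht₁ v => ?_⟩, fun hr s => ?_, ?_⟩
  · by_cases h : t₁ ∈ tsupport χ
    · have hγt₁ := hγ.contMDiffAt (hJ.mem_nhds ht₁)
      refine contDiffAt_apply_coordFrameField (fun s => canonicalX (γ s) (α s)) hγt₁ (hχ h).2
        (mem_chartDomain _) ?_
      refine (hχs.contDiffAt.mul (contDiffAt_const (c := r))).congr_of_eventuallyEq ?_
      filter_upwards [eventually_mem_chartDomain hγt₁.continuousAt (hχ h).2] with s hs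
      exact hX s hs
    · refine (contDiffAt_const (c := (0 : ℝ))).congr_of_eventuallyEq ?_
      filter_upwards [(isClosed_tsupport χ).isOpen_compl.mem_nhds h] with s hs
      rw [coeffAlong, (hzero s (image_eq_zero_of_notMem_tsupport hs)).1]
      rfl
  · by_cases h : t₁ ∈ tsupport χ
    · have hγt₁ := hγ.contMDiffAt (hJ.mem_nhds ht₁)
      refine contDiffAt_apply_coordFrameField
        (fun s => D.splitting (γ s) (α s) (extendVec v (γ s))) hγt₁ (hχ h).2
        (mem_chartDomain _) ?_
      have h1 : ContDiffAt ℝ ∞ (fun s => chartCoord (γ t) (γ s) (extendVec v (γ s))) t₁ :=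
        contDiffAt_chartCoord_of_contMDiffAt ((contMDiffAt_chartVec (mem_chartDomain (n := n) (γ t₁))
          (chartCoord (γ t₁) (γ t₁) v)).comp t₁ hγt₁) (hχ h).2
      have h2 := hχs.contDiffAt.mul
        ((LinearMap.toContinuousLinearMap l).contDiff.contDiffAt.comp t₁ h1)
      refine h2.congr_of_eventuallyEq ?_
      filter_upwards [eventually_mem_chartDomain hγt₁.continuousAt (hχ h).2] with s hs
      exact hμ s hs _
    · refine (contDiffAt_const (c := (0 : ℝ))).congr_of_eventuallyEq ?_
      filter_upwards [(isClosed_tsupport χ).isOpen_compl.mem_nhds h] with s hs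
      rw [coeffAlong, (hzero s (image_eq_zero_of_notMem_tsupport hs)).2]
      rfl
  · by_cases hs : γ s ∈ chartDomain (n := n) (γ t)
    · rw [hα s hs, (hF s hs).1, hr, mul_zero, map_zero]
    · rw [hα0 s hs, map_zero]
  · filter_upwards [eventually_mem_chartDomain hγt.continuousAt htt, χ.eventuallyEq_one] with s hs h1
    rw [Pi.one_apply] at h1
    exact ⟨by rw [hX s hs, h1, one_mul], fun v => by rw [hμ s hs, h1, one_mul]⟩

lemma xval_of_apply {α : Cotractor n (γ t)} {r : ℝ}
    (h : (canonicalX (γ t) α).1 (coordFrameField (γ t) (γ t)) = r) : xval (γ t) α = r := by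
  rw [coordFrameField_self] at h
  exact h

lemma mval_of_apply {α : Cotractor n (γ t)} {r : ℝ} {v : TangentSpace (𝓡 n) (γ t)}
    (h : (D.splitting (γ t) α v).1 (coordFrameField (γ t) (γ t)) = r) : D.mval (γ t) v α = r := by
  rw [coordFrameField_self] at h
  exact h

/-- An incident `2`-tractor is of the form `X ∧ W`. -/
lemma Incident.apply_eq {x : M} {S : TwoTractor n x} (hS : Incident x S) {δ : Cotractor n x}
    (hδ : xval x δ = 1) (α β : Cotractor n x) :
    S ![α, β] = xval x α * S ![δ, β] - xval x β * S ![δ, α] := by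
  have h := congrArg (fun φ : Density 1 n (TangentSpace (𝓡 n) x) => φ.1 (coordFrame x)) (hS α β δ)
  simp only [Density.add_apply, Density.smul_apply, Density.zero_apply] at h
  change S ![β, δ] * xval x α + S ![δ, α] * xval x β + S ![α, β] * xval x δ = 0 at h
  rw [hδ, alternating_swap S β δ] at h
  linear_combination h

/-- The derivative of `ρ ⊗ γ'` divided by `ρ`. -/
def weightedAccel (γ : ℝ → M) (ρ : (s : ℝ) → Density (-2) n (TangentSpace (𝓡 n) (γ s)))
    (t : ℝ) : TangentSpace (𝓡 n) (γ t) :=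
  D.logDerivAlong γ ρ t • velocity γ t + D.vectorDerivAlong γ (velocity γ) t

lemma exists_dual_velocity_eq_one (hv : velocity (n := n) γ t ≠ 0) :
    ∃ l : EuclideanSpace ℝ (Fin n) →ₗ[ℝ] ℝ, l (chartCoord (γ t) (γ t) (velocity γ t)) = 1 := by
  have hne : chartCoord (γ t) (γ t) (velocity (n := n) γ t) ≠ 0 := fun h => hv (by
    rw [← chartVec_chartCoord (mem_chartDomain (n := n) (γ t)) (velocity γ t), h, map_zero])
  obtain ⟨l, hl⟩ := SeparatingDual.exists_eq_one (R := ℝ) hne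
  exact ⟨l, hl⟩

lemma cotractor_ext_val {x : M} {α β : Cotractor n x} (h : xval x α = xval x β)
    (h' : ∀ v, D.mval x v α = D.mval x v β) : α = β :=
  D.cotractor_ext (Density.ext_basis (coordFrame x) h)
    (LinearMap.ext fun v => Density.ext_basis (coordFrame x) (h' v))

lemma contDiffAt_curveTractor (hJ : IsOpen J) (hγ : ContMDiffOn 𝓘(ℝ) (𝓡 n) ∞ γ J)
    (ht : t ∈ J) {ρ : (s : ℝ) → Density (-2) n (TangentSpace (𝓡 n) (γ s))}
    (hρ : IsSmoothDensityAlong γ J ρ) {α β : (s : ℝ) → Cotractor n (γ s)}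
    (hα : D.IsSmoothCotractorAlong γ J α) (hβ : D.IsSmoothCotractorAlong γ J β) :
    ContDiffAt ℝ ∞ (fun s => D.curveTractor γ ρ s ![α s, β s]) t := by
  have hγt := hγ.contMDiffAt (hJ.mem_nhds ht)
  have htt := mem_chartDomain (n := n) (γ t)
  have hm : ∀ {α : (s : ℝ) → Cotractor n (γ s)}, D.IsSmoothCotractorAlong γ J α →
      ContDiffAt ℝ ∞ (fun s =>
        (D.splitting (γ s) (α s) (velocity γ s)).1 (coordFrameField (γ t) (γ s))) t := by
    intro α hα
    refine ContDiffAt.congr_of_eventuallyEq ?_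
      (D.splitting_velocity_eventuallyEq hγt.continuousAt α)
    refine ContDiffAt.sum fun i _ => ContDiffAt.mul ?_ (hα.2 t ht _)
    exact ((EuclideanSpace.proj i : EuclideanSpace ℝ (Fin n) →L[ℝ] ℝ).contDiff.contDiffAt).comp t
      (contDiffAt_chartCoord_velocity hJ hγ ht htt)
  refine ((hρ t ht).mul (((hα.1 t ht).mul (hm hβ)).sub
    ((hβ.1 t ht).mul (hm hα)))).congr_of_eventuallyEq ?_
  filter_upwards [eventually_mem_chartDomain hγt.continuousAt htt] with s hs
  exact D.curveTractor_apply_chart ρ hs (α s) (β s)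

/-- The derivative of `k ρ ⊗ γ'` is `ρ ⊗ Z`, and `Z` is the only obstruction to parallelism. It is a
free variable, so that it can be taken as the expression itself or as `0`. -/
lemma hasDerivAt_smul_curveTractor (hJ : IsOpen J) (hγ : ContMDiffOn 𝓘(ℝ) (𝓡 n) ∞ γ J)
    (ht : t ∈ J) {ρ : (s : ℝ) → Density (-2) n (TangentSpace (𝓡 n) (γ s))}
    (hρ : IsSmoothDensityAlong γ J ρ) (hρ0 : (ρ t).1 (coordFrame (γ t)) ≠ 0)
    {k : ℝ → ℝ} (hk : DifferentiableAt ℝ k t)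
    {α β : (s : ℝ) → Cotractor n (γ s)} (hα : D.IsSmoothCotractorAlong γ J α)
    (hβ : D.IsSmoothCotractorAlong γ J β) {α' β' : Cotractor n (γ t)}
    (hα' : D.IsCotractorDeriv γ α t α') (hβ' : D.IsCotractorDeriv γ β t β')
    (Z : TangentSpace (𝓡 n) (γ t))
    (hZ : Z = deriv k t • velocity γ t + k t • D.weightedAccel γ ρ t) :
    HasDerivAt (fun s => k s * D.curveTractor γ ρ s ![α s, β s])
      (k t * D.curveTractor γ ρ t ![α', β t] + k t * D.curveTractor γ ρ t ![α t, β']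
        + (ρ t).1 (coordFrame (γ t)) *
          (xval (γ t) (α t) * D.mval (γ t) Z (β t) - xval (γ t) (β t) * D.mval (γ t) Z (α t))) t := by
  have hρt := (hρ t ht).differentiableAt (by simp)
  have h := hk.hasDerivAt.mul (D.hasDerivAt_curveTractor hJ hγ ht hρt hα hβ hα' hβ' _ rfl)
  refine h.congr_deriv ?_
  have h0 : coeffAlong γ ρ t t ≠ 0 := by rwa [coeffAlong_self]
  have hl : deriv (coeffAlong γ ρ t) t + -2 / ((n : ℝ) + 1)
      * D.traceGam (γ t) (velocity γ t) * coeffAlong γ ρ t t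
        = coeffAlong γ ρ t t * D.logDerivAlong γ ρ t := (mul_div_cancel₀ _ h0).symm
  rw [hl, coeffAlong_self, hZ, curveTractor_apply D ρ (α t) (β t)]
  simp only [weightedAccel, ← mform_apply, map_add, map_smul, smul_eq_mul]
  ring

/-- Pointwise form of an incident parallel `2`-tractor along a regular curve. -/
lemma exists_eq_smul_curveTractor [T2Space M] (hγ : IsRegularCurve (n := n) γ J) (ht : t ∈ J)
    (ρ : (s : ℝ) → Density (-2) n (TangentSpace (𝓡 n) (γ s)))
    (hρ0 : (ρ t).1 (coordFrame (γ t)) ≠ 0) {S : (s : ℝ) → TwoTractor n (γ s)}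
    (hS : D.IsParallelAlong γ J S) (hSi : ∀ s ∈ J, Incident (γ s) (S s)) :
    ∃ k : ℝ, S t = k • D.curveTractor γ ρ t := by
  have hJ := hγ.isOpen
  have htt := mem_chartDomain (n := n) (γ t)
  -- With `δ = (1, 0)` and `L = Σ(δ, ·)`, incidence reads `Σ = X ∧ L`. It remains to show that `L`
  -- is a multiple of `μ(γ')`.
  obtain ⟨δ, hδ, hδ'⟩ := D.exists_cotractor_val (γ t) 1 0
  let L : Cotractor n (γ t) →ₗ[ℝ] ℝ := (S t).toMultilinearMap.toLinearMap ![δ, 0] 1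
  have hL : ∀ β, L β = S t ![δ, β] := fun β => by
    change S t (Function.update ![δ, 0] 1 β) = _
    congr 1
    ext i
    fin_cases i <;> rfl
  have hLδ : L δ = 0 := by
    rw [hL]
    exact (S t).map_eq_zero_of_eq ![δ, δ] (i := 0) (j := 1) rfl (by decide)
  have hSt : ∀ α β, S t ![α, β] = xval (γ t) α * L β - xval (γ t) β * L α := fun α β => by
    rw [hL, hL]
    exact Incident.apply_eq (hSi t ht) hδ α β
  -- For fields `A`, `B` with `σ = 0` incidence gives `Σ(A, B) = 0` on `J`. The derivative `A'` has
  -- `X(A') = -μ_A(γ')`, and likewise for `B`, so the parallel equation becomes this proportionality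
  -- on the kernel of `X`.
  have key : ∀ l l' : EuclideanSpace ℝ (Fin n) →ₗ[ℝ] ℝ, ∀ a b : Cotractor n (γ t),
      xval (γ t) a = 0 → xval (γ t) b = 0 →
      (∀ v, D.mval (γ t) v a = l (chartCoord (γ t) (γ t) v)) →
      (∀ v, D.mval (γ t) v b = l' (chartCoord (γ t) (γ t) v)) →
      D.mval (γ t) (velocity γ t) a * L b = D.mval (γ t) (velocity γ t) b * L a := by
    intro l l' a b ha hb ha' hb'
    obtain ⟨A, hA, hA0, hAt⟩ := D.exists_cotractor_field hJ hγ.smooth ht 0 l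
    obtain ⟨B, hB, hB0, hBt⟩ := D.exists_cotractor_field hJ hγ.smooth ht 0 l'
    have hAa : A t = a := D.cotractor_ext_val
      ((xval_of_apply hAt.self_of_nhds.1).trans ha.symm) fun v =>
      (D.mval_of_apply (hAt.self_of_nhds.2 v)).trans (ha' v).symm
    have hBb : B t = b := D.cotractor_ext_val
      ((xval_of_apply hBt.self_of_nhds.1).trans hb.symm) fun v =>
      (D.mval_of_apply (hBt.self_of_nhds.2 v)).trans (hb' v).symm
    obtain ⟨A', hA'⟩ := D.exists_isCotractorDeriv hA ht
    obtain ⟨B', hB'⟩ := D.exists_isCotractorDeriv hB ht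
    have hx : ∀ {A : (s : ℝ) → Cotractor n (γ s)} {A' : Cotractor n (γ t)},
        D.IsSmoothCotractorAlong γ J A → D.IsCotractorDeriv γ A t A' →
        (∀ s, canonicalX (γ s) (A s) = 0) →
        xval (γ t) A' = -D.mval (γ t) (velocity γ t) (A t) := by
      intro A A' hA hA' h0
      have h1 := D.hasDerivAt_canonicalX ht hA hA'
      have h2 : coeffAlong γ (fun s => canonicalX (γ s) (A s)) t = fun _ => 0 := by
        ext s
        rw [coeffAlong, h0]
        rfl
      rw [h2] at h1
      have h3 := h1.unique (hasDerivAt_const t (0 : ℝ))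
      have h4 : xval (γ t) (A t) = 0 := by
        change (canonicalX (γ t) (A t)).1 (coordFrame (γ t)) = 0
        rw [h0]
        rfl
      rw [h4] at h3
      linear_combination h3
    have h1 := hS A B hA hB t ht A' B' hA' hB'
    have h2 : (fun s => S s ![A s, B s]) =ᶠ[𝓝 t] fun _ => 0 := by
      filter_upwards [hJ.mem_nhds ht] with s hs
      obtain ⟨δ', hδ', -⟩ := D.exists_cotractor_val (γ s) 1 0
      have h4 : ∀ {A : Cotractor n (γ s)}, canonicalX (γ s) A = 0 → xval (γ s) A = 0 := by
        intro A h
        change (canonicalX (γ s) A).1 (coordFrame (γ s)) = 0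
        rw [h]
        rfl
      rw [Incident.apply_eq (hSi s hs) hδ' (A s) (B s), h4 (hA0 rfl s), h4 (hB0 rfl s)]
      ring
    have h3 := (h1.congr_of_eventuallyEq h2.symm).unique (hasDerivAt_const t (0 : ℝ))
    rw [hSt, hSt, hAa, hBb, ha, hb, hx hA hA' (hA0 rfl), hx hB hB' (hB0 rfl), hAa, hBb] at h3
    linear_combination -h3
  -- Take `a = (0, μ)` with `μ(γ') = 1`; then `key` gives `L b = L a * μ_b(γ')` when `X(b) = 0`. For
  -- general `b`, subtract `X(b) δ`, which changes neither `L b` nor `μ_b`.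
  obtain ⟨l₁, hl₁⟩ := exists_dual_velocity_eq_one (hγ.velocity_ne_zero t ht)
  obtain ⟨a, ha, ha'⟩ := D.exists_cotractor_val (γ t) 0 (l₁ ∘ₗ chartCoord (γ t) (γ t))
  have hLb : ∀ b, L b = D.mval (γ t) (velocity γ t) b * L a := by
    intro b
    let b₀ := b - xval (γ t) b • δ
    have hb₀ : xval (γ t) b₀ = 0 := by
      simp only [b₀, map_sub, map_smul, hδ, smul_eq_mul, mul_one, sub_self]
    have hb₁ : ∀ v, D.mval (γ t) v b₀ = D.mval (γ t) v b := fun v => by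
      simp only [b₀, map_sub, map_smul, hδ', LinearMap.zero_apply, smul_zero, sub_zero]
    have hb₂ : L b₀ = L b := by
      simp only [b₀, map_sub, map_smul, hLδ, smul_zero, sub_zero]
    have h := key l₁ (D.mform (γ t) b ∘ₗ chartVec (γ t) (γ t)) a b₀ ha hb₀ ha' fun v => by
      rw [hb₁, LinearMap.comp_apply, chartVec_chartCoord htt]
      rfl
    rw [ha', hb₁, hb₂, LinearMap.comp_apply, hl₁, one_mul] at h
    exact h
  refine ⟨L a / (ρ t).1 (coordFrame (γ t)), alternating_ext fun α β => ?_⟩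
  rw [AlternatingMap.smul_apply, curveTractor_apply, hSt, hLb α, hLb β, smul_eq_mul]
  field_simp

/-- The nonzero incident parallel `2`-tractors along a regular curve are the tractors
`2 X^{[α} W^{β]}_b u^b`, where `u = k ρ ⊗ γ'` is parallel along the curve. -/
lemma isGeodesicTractor_iff [T2Space M] (hγ : IsRegularCurve (n := n) γ J)
    {ρ : (s : ℝ) → Density (-2) n (TangentSpace (𝓡 n) (γ s))}
    (hρ : IsSmoothDensityAlong γ J ρ) (hρ0 : ∀ s ∈ J, 0 < (ρ s).1 (coordFrame (γ s)))
    (S : (s : ℝ) → TwoTractor n (γ s)) :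
    D.IsGeodesicTractor γ J S ↔ ∃ k : ℝ → ℝ, ContDiffOn ℝ ∞ k J ∧ (∃ t ∈ J, k t ≠ 0) ∧
      (∀ t ∈ J, S t = k t • D.curveTractor γ ρ t) ∧
      ∀ t ∈ J, deriv k t • velocity γ t + k t • D.weightedAccel γ ρ t = 0 := by
  have hJ := hγ.isOpen
  constructor
  · intro hS
    choose! k hk using fun t (ht : t ∈ J) =>
      D.exists_eq_smul_curveTractor hγ ht ρ (hρ0 t ht).ne' hS.parallel hS.incident
    -- Near `t`, `k` is the quotient of `Σ(A, B)` by the value of `curveTractor` on `(A, B)`, for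
    -- fields that are `(1, 0)` and `(0, l₁)` near `t` with `l₁(γ') = 1` at `t`; the denominator at
    -- `t` is then the value of `ρ`.
    have hkd : ∀ t ∈ J, ContDiffAt ℝ ∞ k t := by
      intro t ht
      have hγt := hγ.smooth.contMDiffAt (hJ.mem_nhds ht)
      have htt := mem_chartDomain (n := n) (γ t)
      obtain ⟨l₁, hl₁⟩ := exists_dual_velocity_eq_one (hγ.velocity_ne_zero t ht)
      obtain ⟨A, hA, -, hAt⟩ := D.exists_cotractor_field hJ hγ.smooth ht 1 0
      obtain ⟨B, hB, -, hBt⟩ := D.exists_cotractor_field hJ hγ.smooth ht 0 l₁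
      have h1 : ContDiffAt ℝ ∞ (fun s => S s ![A s, B s]) t :=
        (hS.smooth A B hA hB).contDiffAt (hJ.mem_nhds ht)
      have h2 := D.contDiffAt_curveTractor hJ hγ.smooth ht hρ hA hB
      have h3 : D.curveTractor γ ρ t ![A t, B t] ≠ 0 := by
        rw [D.curveTractor_apply_chart ρ htt, hAt.self_of_nhds.1, hBt.self_of_nhds.1,
          hBt.self_of_nhds.2, hl₁, coordFrameField_self]
        simpa using (hρ0 t ht).ne'
      refine (h1.div h2 h3).congr_of_eventuallyEq ?_
      filter_upwards [hJ.mem_nhds ht, h2.continuousAt.eventually_ne h3] with s hs h4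
      rw [Pi.div_apply, hk s hs, AlternatingMap.smul_apply, smul_eq_mul, mul_div_cancel_right₀ _ h4]
    refine ⟨k, fun t ht => (hkd t ht).contDiffWithinAt, ?_, hk, fun t ht => ?_⟩
    · obtain ⟨t, ht, h⟩ := hS.ne_zero
      refine ⟨t, ht, fun h0 => h ?_⟩
      rw [hk t ht, h0, zero_smul]
    · have htt := mem_chartDomain (n := n) (γ t)
      rw [← chartVec_chartCoord htt (_ + _)]
      refine (congrArg _ ?_).trans (map_zero _)
      -- Every covector `l` is tested: on `(1, 0)` and `(0, l)` the two expressions for the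
      -- derivative of `Σ(A, B)` differ by `ρ l(Z)`.
      refine (Module.forall_dual_apply_eq_zero_iff ℝ _).1 fun l => ?_
      obtain ⟨A, hA, -, hAt⟩ := D.exists_cotractor_field hJ hγ.smooth ht 1 0
      obtain ⟨B, hB, -, hBt⟩ := D.exists_cotractor_field hJ hγ.smooth ht 0 l
      obtain ⟨A', hA'⟩ := D.exists_isCotractorDeriv hA ht
      obtain ⟨B', hB'⟩ := D.exists_isCotractorDeriv hB ht
      have h1 := hS.parallel A B hA hB t ht A' B' hA' hB'
      have h2 := D.hasDerivAt_smul_curveTractor hJ hγ.smooth ht hρ (hρ0 t ht).ne'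
        ((hkd t ht).differentiableAt (by simp)) hA hB hA' hB' _ rfl
      have h3 : (fun s => S s ![A s, B s]) =ᶠ[𝓝 t]
          fun s => k s * D.curveTractor γ ρ s ![A s, B s] := by
        filter_upwards [hJ.mem_nhds ht] with s hs
        rw [hk s hs, AlternatingMap.smul_apply, smul_eq_mul]
      have h4 := (h1.congr_of_eventuallyEq h3.symm).unique h2
      rw [hk t ht, AlternatingMap.smul_apply, AlternatingMap.smul_apply, smul_eq_mul, smul_eq_mul,
        xval_of_apply hAt.self_of_nhds.1, xval_of_apply hBt.self_of_nhds.1,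
        D.mval_of_apply (hBt.self_of_nhds.2 _)] at h4
      have h5 := (mul_eq_zero.1 (left_eq_add.1 h4)).resolve_left (hρ0 t ht).ne'
      linear_combination h5
  · rintro ⟨k, hk, ⟨t₁, ht₁, hkt₁⟩, hS, hE⟩
    have hkd : ∀ t ∈ J, ContDiffAt ℝ ∞ k t := fun t ht => hk.contDiffAt (hJ.mem_nhds ht)
    have he : ∀ t ∈ J, ∀ A B : (s : ℝ) → Cotractor n (γ s), (fun s => S s ![A s, B s]) =ᶠ[𝓝 t]
        fun s => k s * D.curveTractor γ ρ s ![A s, B s] := by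
      intro t ht A B
      filter_upwards [hJ.mem_nhds ht] with s hs
      rw [hS s hs, AlternatingMap.smul_apply, smul_eq_mul]
    refine ⟨fun A B hA hB t ht => ?_, fun A B hA hB t ht A' B' hA' hB' => ?_, ⟨t₁, ht₁, ?_⟩,
      fun t ht α β δ => ?_⟩
    · exact (((hkd t ht).mul (D.contDiffAt_curveTractor hJ hγ.smooth ht hρ hA
        hB)).congr_of_eventuallyEq (he t ht A B)).contDiffWithinAt
    · have h2 := D.hasDerivAt_smul_curveTractor hJ hγ.smooth ht hρ (hρ0 t ht).ne'
        ((hkd t ht).differentiableAt (by simp)) hA hB hA' hB' 0 (hE t ht).symm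
      refine (h2.congr_of_eventuallyEq (he t ht A B)).congr_deriv ?_
      rw [hS t ht, AlternatingMap.smul_apply, AlternatingMap.smul_apply, smul_eq_mul, smul_eq_mul]
      simp only [← mform_apply, map_zero, mul_zero, sub_zero, add_zero]
    · intro h0
      obtain ⟨l₁, hl₁⟩ := exists_dual_velocity_eq_one (hγ.velocity_ne_zero t₁ ht₁)
      obtain ⟨a, ha, ha'⟩ := D.exists_cotractor_val (γ t₁) 1 0
      obtain ⟨b, hb, hb'⟩ := D.exists_cotractor_val (γ t₁) 0 (l₁ ∘ₗ chartCoord (γ t₁) (γ t₁))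
      have h1 := DFunLike.congr_fun ((hS t₁ ht₁).symm.trans h0) ![a, b]
      rw [AlternatingMap.smul_apply, curveTractor_apply, ha, hb, hb', LinearMap.comp_apply,
        hl₁] at h1
      have h2 : k t₁ * (ρ t₁).1 (coordFrame (γ t₁)) = 0 := by
        simpa using h1
      exact (mul_ne_zero hkt₁ (hρ0 t₁ ht₁).ne') h2
    · refine Density.ext_basis (coordFrame (γ t)) ?_
      simp only [Density.add_apply, Density.smul_apply, Density.zero_apply, hS t ht,
        AlternatingMap.smul_apply, curveTractor_apply, smul_eq_mul]
      change _ * xval (γ t) α + _ * xval (γ t) β + _ * xval (γ t) δ = 0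
      ring

end AffineConnection

end ProjectiveTractor

end

/-! ### The transport equation for `k` and the geodesic equation. -/

noncomputable section

namespace ProjectiveTractor

/-- A smooth function on an open interval has a smooth antiderivative. -/
lemma exists_antideriv {J : Set ℝ} (hJ : IsOpen J) (hJc : J.OrdConnected) (hJn : J.Nonempty)
    {θ : ℝ → ℝ} (hθ : ContDiffOn ℝ ∞ θ J) :
    ∃ Θ : ℝ → ℝ, ContDiffOn ℝ ∞ Θ J ∧ ∀ t ∈ J, HasDerivAt Θ (θ t) t := by
  obtain ⟨t₁, ht₁⟩ := hJn
  have hd : ∀ t ∈ J, HasDerivAt (fun t => ∫ s in t₁..t, θ s) (θ t) t := fun t ht =>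
    intervalIntegral.integral_hasDerivAt_right
      (hθ.continuousOn.mono (hJc.uIcc_subset ht₁ ht)).intervalIntegrable
      (hθ.continuousOn.stronglyMeasurableAtFilter hJ t ht)
      (hθ.continuousOn.continuousAt (hJ.mem_nhds ht))
  refine ⟨_, (contDiffOn_infty_iff_deriv_of_isOpen hJ).2
    ⟨fun t ht => (hd t ht).differentiableAt.differentiableWithinAt, ?_⟩, hd⟩
  exact hθ.congr fun t ht => (hd t ht).deriv

variable {n : ℕ} {M : Type*} [TopologicalSpace M] [ChartedSpace (EuclideanSpace ℝ (Fin n)) M]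
  [IsManifold (𝓡 n) ∞ M] {γ : ℝ → M} {t : ℝ} {J : Set ℝ}

namespace AffineConnection

section Transport

variable (D : AffineConnection n M) {ρ : (s : ℝ) → Density (-2) n (TangentSpace (𝓡 n) (γ s))}

/-- In the fixed chart at `γ t`, `vectorDerivAlong_eq` gives a continuous expression. Its local
boundedness provides the Lipschitz constant for the uniqueness theorem. -/
lemma continuousAt_chartCoord_weightedAccel [T2Space M] (hJ : IsOpen J)
    (hγ : ContMDiffOn 𝓘(ℝ) (𝓡 n) ∞ γ J) (ht : t ∈ J) (hρ : IsSmoothDensityAlong γ J ρ)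
    (hρ0 : ∀ s ∈ J, 0 < (ρ s).1 (coordFrame (γ s))) :
    ContinuousAt (fun s => chartCoord (γ t) (γ s) (D.weightedAccel γ ρ s)) t := by
  have hγt := hγ.contMDiffAt (hJ.mem_nhds ht)
  have htt := mem_chartDomain (n := n) (γ t)
  set c : ℝ → EuclideanSpace ℝ (Fin n) := fun s => chartCoord (γ t) (γ s) (velocity γ s)
  have hc : ContDiffAt ℝ ∞ c t := contDiffAt_chartCoord_velocity hJ hγ ht htt
  have hd : ContinuousAt (deriv c) t := by
    have := (hc.fderiv_right (m := ∞) (by simp)).clm_apply (contDiffAt_const (c := (1 : ℝ)))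
    exact this.continuousAt
  have hθ : ContinuousAt (D.logDerivAlong γ ρ) t :=
    (D.contDiffOn_logDerivAlong hJ hγ ρ hρ fun s hs => (hρ0 s hs).ne').continuousOn.continuousAt
      (hJ.mem_nhds ht)
  have h : ContinuousAt (fun s => D.logDerivAlong γ ρ s • c s + (deriv c s + ∑ i, c s i •
      chartCoord (γ t) (γ s) (D.cov (fun y => chartVec (γ t) y (EuclideanSpace.single i 1)) (γ s)
        (velocity γ s)))) t := by
    refine (hθ.smul hc.continuousAt).add (hd.add (tendsto_finsetSum _ fun i _ => ?_))
    refine ContinuousAt.smul (f := fun s => c s i) ?_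
      (D.contDiffAt_chartCoord_cov hJ hγ ht htt _).continuousAt
    exact ((EuclideanSpace.proj i : EuclideanSpace ℝ (Fin n) →L[ℝ] ℝ).continuous.continuousAt).comp
      hc.continuousAt
  refine h.congr ?_
  filter_upwards [eventually_mem_chartDomain hγt.continuousAt htt, hJ.mem_nhds ht] with s hs hsJ
  have hcs : DifferentiableAt ℝ c s :=
    (contDiffAt_chartCoord_velocity hJ hγ hsJ hs).differentiableAt (by simp)
  rw [weightedAccel, D.vectorDerivAlong_eq ((hγ.contMDiffAt (hJ.mem_nhds hsJ)).mdifferentiableAt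
    (by simp)) hs _ hcs]
  simp only [map_add, map_smul, map_sum, chartCoord_chartVec hs, c]

/-- The equation `∇_{γ'} (k ρ ⊗ γ') = 0` implies a linear equation for `k`, locally. -/
lemma exists_bound_weightedAccel [T2Space M] (hγ : IsRegularCurve (n := n) γ J) (ht : t ∈ J)
    (hρ : IsSmoothDensityAlong γ J ρ) (hρ0 : ∀ s ∈ J, 0 < (ρ s).1 (coordFrame (γ s))) :
    ∃ (C : ℝ) (r : ℝ → ℝ), ∀ᶠ s in 𝓝 t, |r s| ≤ C ∧ ∀ k k' : ℝ,
      k' • velocity (n := n) γ s + k • D.weightedAccel γ ρ s = 0 → k' = r s * k := by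
  -- Since `l(γ')` is `1` at `t`, it stays nonzero nearby, and pairing the vector equation with `l`
  -- solves it for `k'`. The other components are not needed.
  obtain ⟨l, hl⟩ := exists_dual_velocity_eq_one (hγ.velocity_ne_zero t ht)
  have hlc : Continuous l := (LinearMap.toContinuousLinearMap l).continuous
  have htt := mem_chartDomain (n := n) (γ t)
  have hc : ContinuousAt (fun s => l (chartCoord (γ t) (γ s) (velocity (n := n) γ s))) t :=
    hlc.continuousAt.comp
      (contDiffAt_chartCoord_velocity hγ.isOpen hγ.smooth ht htt).continuousAt
  have ha : ContinuousAt (fun s => l (chartCoord (γ t) (γ s) (D.weightedAccel γ ρ s))) t :=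
    hlc.continuousAt.comp (D.continuousAt_chartCoord_weightedAccel hγ.isOpen hγ.smooth ht hρ hρ0)
  have hc0 : l (chartCoord (γ t) (γ t) (velocity (n := n) γ t)) ≠ 0 := by
    rw [hl]
    exact one_ne_zero
  have hr := (ha.neg.div hc hc0).abs
  obtain ⟨C, hC⟩ : ∃ C, ∀ᶠ s in 𝓝 t, |-l (chartCoord (γ t) (γ s) (D.weightedAccel γ ρ s))
      / l (chartCoord (γ t) (γ s) (velocity (n := n) γ s))| < C :=
    ⟨_, Filter.Tendsto.eventually_lt_const (lt_add_one _) hr⟩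
  refine ⟨C, fun s => -l (chartCoord (γ t) (γ s) (D.weightedAccel γ ρ s))
    / l (chartCoord (γ t) (γ s) (velocity (n := n) γ s)), ?_⟩
  filter_upwards [hc.eventually_ne hc0, hC] with s hs hb
  refine ⟨hb.le, fun k k' h => ?_⟩
  have h1 := congrArg (fun v => l (chartCoord (γ t) (γ s) v)) h
  simp only [map_add, map_smul, map_zero, smul_eq_mul] at h1
  field_simp
  linear_combination h1

/-- Near `t`, both `k` and the zero function solve `k' = r k` with bounded `r`, and they agree at
`t`; uniqueness for ordinary differential equations applies. -/
lemma eventually_eq_zero_of_transport [T2Space M] (hγ : IsRegularCurve (n := n) γ J) (ht : t ∈ J)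
    (hρ : IsSmoothDensityAlong γ J ρ) (hρ0 : ∀ s ∈ J, 0 < (ρ s).1 (coordFrame (γ s)))
    {k : ℝ → ℝ} (hk : ContDiffOn ℝ ∞ k J)
    (hE : ∀ t ∈ J, deriv k t • velocity γ t + k t • D.weightedAccel γ ρ t = 0) (h0 : k t = 0) :
    ∀ᶠ s in 𝓝 t, k s = 0 := by
  obtain ⟨C, r, hr⟩ := D.exists_bound_weightedAccel hγ ht hρ hρ0
  obtain ⟨ε, hε, hb⟩ := Metric.eventually_nhds_iff_ball.1 (hr.and (hγ.isOpen.mem_nhds ht))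
  rw [Real.ball_eq_Ioo] at hb
  have htI : t ∈ Ioo (t - ε) (t + ε) := ⟨by linarith, by linarith⟩
  have h := ODE_solution_unique_of_mem_Ioo (v := fun s x => r s * x) (s := fun _ => univ)
    (K := C.toNNReal) (f := k) (g := fun _ => 0) (fun s hs => ?_) htI (fun s hs => ⟨?_, mem_univ _⟩)
    (fun s _ => ⟨?_, mem_univ _⟩) h0
  · filter_upwards [Ioo_mem_nhds htI.1 htI.2] with s hs
    exact h hs
  · refine LipschitzWith.lipschitzOnWith (LipschitzWith.of_dist_le_mul fun x y => ?_)
    rw [Real.dist_eq, Real.dist_eq, ← mul_sub, abs_mul]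
    gcongr
    exact (hb s hs).1.1.trans (Real.le_coe_toNNReal C)
  · have hs' := (hb s hs).2
    exact ((hk.contDiffAt (hγ.isOpen.mem_nhds hs')).differentiableAt
      (by simp)).hasDerivAt.congr_deriv ((hb s hs).1.2 _ _ (hE s hs'))
  · simpa using hasDerivAt_const s (0 : ℝ)

/-- A parallel field `k ρ ⊗ γ'` that does not vanish at some point is a nowhere vanishing multiple
of a positive one. -/
lemma pos_or_neg_of_transport [T2Space M] (hγ : IsRegularCurve (n := n) γ J)
    (hρ : IsSmoothDensityAlong γ J ρ) (hρ0 : ∀ s ∈ J, 0 < (ρ s).1 (coordFrame (γ s)))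
    {k : ℝ → ℝ} (hk : ContDiffOn ℝ ∞ k J)
    (hE : ∀ t ∈ J, deriv k t • velocity γ t + k t • D.weightedAccel γ ρ t = 0)
    (h0 : ∃ t ∈ J, k t ≠ 0) : (∀ t ∈ J, 0 < k t) ∨ ∀ t ∈ J, k t < 0 := by
  have hJ := hγ.isOpen
  have hJc : IsPreconnected J := hγ.ordConnected.isPreconnected
  obtain ⟨t₁, ht₁, hkt₁⟩ := h0
  have hu : IsOpen (J ∩ k ⁻¹' {0}ᶜ) := hk.continuousOn.isOpen_inter_preimage hJ isOpen_compl_singleton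
  have hv : IsOpen {t | t ∈ J ∧ k t = 0} := isOpen_iff_mem_nhds.2 fun t ht =>
    (hJ.eventually_mem ht.1).and
      (D.eventually_eq_zero_of_transport hγ ht.1 hρ hρ0 hk hE ht.2)
  -- The zeros and the non-zeros of `k` are disjoint open sets covering the connected set `J`, and
  -- the second is nonempty.
  have hne : ∀ t ∈ J, k t ≠ 0 := fun t ht => (hJc.subset_left_of_subset_union hu hv
    (Set.disjoint_left.2 fun t h h' => h.2 h'.2)
    (fun t ht => (ne_or_eq (k t) 0).imp (⟨ht, ·⟩) (⟨ht, ·⟩)) ⟨t₁, ht₁, ht₁, hkt₁⟩ ht).2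
  by_contra! h
  obtain ⟨⟨a, ha, hka⟩, b, hb, hkb⟩ := h
  obtain ⟨c, hc, hkc⟩ := hJc.intermediate_value ha hb hk.continuousOn ⟨hka, hkb⟩
  exact hne c hc hkc

/-- A parallel field `k ρ ⊗ γ'` is determined up to a constant. -/
lemma exists_eq_mul_of_transport (hγ : IsRegularCurve (n := n) γ J) {k k₀ : ℝ → ℝ}
    (hk : ContDiffOn ℝ ∞ k J) (hk₀ : ContDiffOn ℝ ∞ k₀ J) (hpos : ∀ t ∈ J, 0 < k₀ t)
    (hE : ∀ t ∈ J, deriv k t • velocity γ t + k t • D.weightedAccel γ ρ t = 0)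
    (hE₀ : ∀ t ∈ J, deriv k₀ t • velocity γ t + k₀ t • D.weightedAccel γ ρ t = 0) :
    ∃ c : ℝ, ∀ t ∈ J, k t = c * k₀ t := by
  have hJ := hγ.isOpen
  have hd : ∀ t ∈ J, HasDerivAt (k / k₀) 0 t := by
    intro t ht
    have h1 := ((hk.contDiffAt (hJ.mem_nhds ht)).differentiableAt (by simp)).hasDerivAt
    have h2 := ((hk₀.contDiffAt (hJ.mem_nhds ht)).differentiableAt (by simp)).hasDerivAt
    refine (h1.div h2 (hpos t ht).ne').congr_deriv ?_
    -- Eliminating the acceleration between the two equations leaves the Wronskian times `γ'`, and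
    -- `γ'` is nonzero.
    have h3 : (deriv k t * k₀ t - k t * deriv k₀ t) • velocity (n := n) γ t = 0 := by
      linear_combination (norm := module) k₀ t • hE t ht - k t • hE₀ t ht
    rw [(smul_eq_zero.1 h3).resolve_right (hγ.velocity_ne_zero t ht), zero_div]
  obtain ⟨c, hc⟩ := hJ.exists_is_const_of_deriv_eq_zero hγ.ordConnected.isPreconnected
    (fun t ht => (hd t ht).differentiableAt.differentiableWithinAt) fun t ht => (hd t ht).deriv
  exact ⟨c, fun t ht => (div_eq_iff (hpos t ht).ne').1 (hc t ht)⟩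

lemma vectorDerivAlong_smul_velocity (hJ : IsOpen J) (hγ : ContMDiffOn 𝓘(ℝ) (𝓡 n) ∞ γ J)
    (ht : t ∈ J) {f : ℝ → ℝ} (hf : DifferentiableAt ℝ f t) :
    D.vectorDerivAlong γ (fun s => f s • velocity γ s) t
      = deriv f t • velocity γ t + f t • D.vectorDerivAlong γ (velocity γ) t := by
  have hγt := (hγ.contMDiffAt (hJ.mem_nhds ht)).mdifferentiableAt (by simp)
  have htt := mem_chartDomain (n := n) (γ t)
  have hc := differentiableAt_chartCoord_velocity hJ hγ ht
  have he : (fun s => chartCoord (γ t) (γ s) (f s • velocity (n := n) γ s))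
      = fun s => f s • chartCoord (γ t) (γ s) (velocity γ s) := by
    simp only [map_smul]
  have hd := hf.hasDerivAt.smul hc.hasDerivAt
  rw [D.vectorDerivAlong_eq hγt htt (fun s => f s • velocity γ s)
      (he ▸ hd.differentiableAt), D.vectorDerivAlong_eq hγt htt _ hc, he]
  rw [show deriv (fun s => f s • chartCoord (γ t) (γ s) (velocity (n := n) γ s)) t = _ from hd.deriv]
  simp only [map_add, map_smul, chartVec_chartCoord htt, PiLp.smul_apply, smul_eq_mul, smul_add,
    Finset.smul_sum, mul_smul]
  abel

/-- A regular curve is an unparametrised geodesic if and only if there is a positive parallel field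
`k ρ ⊗ γ'` along it. -/
lemma isUnparamGeodesic_iff [T2Space M] (hγ : IsRegularCurve (n := n) γ J)
    (hρ : IsSmoothDensityAlong γ J ρ) (hρ0 : ∀ s ∈ J, 0 < (ρ s).1 (coordFrame (γ s))) :
    D.IsUnparamGeodesic γ J ↔ ∃ k : ℝ → ℝ, ContDiffOn ℝ ∞ k J ∧ (∀ t ∈ J, 0 < k t) ∧
      ∀ t ∈ J, deriv k t • velocity γ t + k t • D.weightedAccel γ ρ t = 0 := by
  have hJ := hγ.isOpen
  -- Since `Θ' = ρ⁻¹ ∇_{γ'} ρ`, the density `e^{-Θ} ρ` is parallel. Writing `k = e^{-Θ} f` turns the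
  -- equation for `k ρ ⊗ γ'` into the one for `f γ'`.
  obtain ⟨Θ, hΘ, hΘd⟩ := exists_antideriv hJ hγ.ordConnected hγ.nonempty
    (D.contDiffOn_logDerivAlong hJ hγ.smooth ρ hρ fun s hs => (hρ0 s hs).ne')
  constructor
  · rintro ⟨f, hf, hpos, h⟩
    refine ⟨fun s => f s * Real.exp (-Θ s), hf.mul (Real.contDiff_exp.comp_contDiffOn hΘ.neg),
      fun t ht => mul_pos (hpos t ht) (Real.exp_pos _), fun t ht => ?_⟩
    have hft := (hf.contDiffAt (hJ.mem_nhds ht)).differentiableAt (by simp)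
    have h1 := (smul_eq_zero.1 (h t ht)).resolve_left (hpos t ht).ne'
    rw [D.vectorDerivAlong_smul_velocity hJ hγ.smooth ht hft] at h1
    have hd : deriv (fun s => f s * Real.exp (-Θ s)) t = _ :=
      (hft.hasDerivAt.mul (hΘd t ht).neg.exp).deriv
    rw [hd, weightedAccel]
    linear_combination (norm := module) Real.exp (-Θ t) • h1
  · rintro ⟨k, hk, hpos, h⟩
    refine ⟨fun s => k s * Real.exp (Θ s), hk.mul (Real.contDiff_exp.comp_contDiffOn hΘ),
      fun t ht => mul_pos (hpos t ht) (Real.exp_pos _), fun t ht => ?_⟩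
    have hkt := (hk.contDiffAt (hJ.mem_nhds ht)).differentiableAt (by simp)
    have hd : HasDerivAt (fun s => k s * Real.exp (Θ s)) _ t :=
      hkt.hasDerivAt.mul (hΘd t ht).exp
    beta_reduce
    rw [D.vectorDerivAlong_smul_velocity hJ hγ.smooth ht hd.differentiableAt,
      hd.deriv]
    have h1 := h t ht
    rw [weightedAccel] at h1
    refine smul_eq_zero_of_right _ ?_
    linear_combination (norm := module) Real.exp (Θ t) • h1

end Transport

end AffineConnection

end ProjectiveTractor

end

/-! ### Projective invariance, and orientation. -/

noncomputable section

namespace ProjectiveTractor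

variable {n : ℕ} {M : Type*} [TopologicalSpace M] [ChartedSpace (EuclideanSpace ℝ (Fin n)) M]
  [IsManifold (𝓡 n) ∞ M] {γ : ℝ → M} {t : ℝ} {J : Set ℝ} {D D' : AffineConnection n M}

namespace ProjEquiv

/-- The change of the connection coefficients under a projective change of connection. -/
lemma exists_gam_eq (h : ProjEquiv D D') (x : M) :
    ∃ υ : TangentSpace (𝓡 n) x →ₗ[ℝ] ℝ,
      ∀ v w, D'.gam x v w = D.gam x v w + υ v • w + υ w • v := by
  obtain ⟨Υ, -, hΥ⟩ := h
  refine ⟨Υ x, fun v w => ?_⟩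
  have := hΥ (extendVec w) x (mdifferentiableAt_extendVec w) v
  rw [extendVec_self] at this
  exact this

/-- The change of the basic invariants under a projective change of connection. -/
lemma exists_traceGam_eq (h : ProjEquiv D D') (x : M) :
    ∃ υ : TangentSpace (𝓡 n) x →ₗ[ℝ] ℝ,
      (∀ v w, D'.gam x v w = D.gam x v w + υ v • w + υ w • v) ∧
      (∀ v, D'.traceGam x v = D.traceGam x v + (n + 1) * υ v) ∧
      ∀ v α, D'.mval x v α = D.mval x v α + υ v * xval x α := by
  obtain ⟨υ, hυ⟩ := h.exists_gam_eq x
  have htr : ∀ v, D'.traceGam x v = D.traceGam x v + (n + 1) * υ v := by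
    intro v
    -- The identity contributes `n υ(v)` to the trace and the rank-one term `υ(v)`; hence the factor
    -- `n + 1`, which cancels the denominator in the connection on densities.
    have he : D'.gam x v = D.gam x v + υ v • LinearMap.id + υ.smulRight v :=
      LinearMap.ext fun w => hυ v w
    have hfd : FiniteDimensional ℝ (TangentSpace (𝓡 n) x) := (coordFrame x).finiteDimensional_of_finite
    have hfr : Module.finrank ℝ (TangentSpace (𝓡 n) x) = n := by
      rw [Module.finrank_eq_card_basis (coordFrame x), Fintype.card_fin]
    rw [AffineConnection.traceGam, he, map_add, map_add, map_smul, LinearMap.trace_id,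
      LinearMap.trace_smulRight, hfr, smul_eq_mul, AffineConnection.traceGam]
    ring
  refine ⟨υ, hυ, htr, fun v α => ?_⟩
  have hn : (n : ℝ) + 1 ≠ 0 := by positivity
  have hm : ∀ (E : AffineConnection n M) (σ : smoothSectionsAt n x),
      E.mval x v ((flatSectionsAt n x).mkQ σ) = mvfderiv (𝓡 n) (coeff x σ.1) x v
        + 1 / ((n : ℝ) + 1) * E.traceGam x v * coeff x σ.1 x := fun E σ =>
    densityOfValue_apply_self _ _
  obtain ⟨σ, rfl⟩ := (flatSectionsAt n x).mkQ_surjective α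
  have hx : xval x ((flatSectionsAt n x).mkQ σ) = coeff x σ.1 x := (coeff_self x σ.1).symm
  refine (hm D' σ).trans ?_
  rw [htr]
  refine Eq.trans ?_ (congrArg₂ (fun a b => a + υ v * b) (hm D σ) hx).symm
  field_simp
  ring

/-- The change `υ(γ') σ` of `μ(γ')` contributes `υ(γ') σ σ'` to both products and drops out of their
difference. -/
lemma curveTractor_eq (h : ProjEquiv D D')
    (ρ : (s : ℝ) → Density (-2) n (TangentSpace (𝓡 n) (γ s))) (t : ℝ) :
    D'.curveTractor γ ρ t = D.curveTractor γ ρ t := by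
  obtain ⟨υ, -, -, hm⟩ := h.exists_traceGam_eq (γ t)
  refine alternating_ext fun α β => ?_
  rw [D'.curveTractor_apply, D.curveTractor_apply, hm, hm]
  ring

/-- The weight `-2` changes the logarithmic derivative of `ρ` by `-2 υ(γ')`, which cancels the
change `2 υ(γ') γ'` of `∇_{γ'} γ'`. -/
lemma weightedAccel_eq (h : ProjEquiv D D')
    {ρ : (s : ℝ) → Density (-2) n (TangentSpace (𝓡 n) (γ s))}
    (hρ0 : 0 < (ρ t).1 (coordFrame (γ t))) : D'.weightedAccel γ ρ t = D.weightedAccel γ ρ t := by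
  obtain ⟨υ, hg, ht, -⟩ := h.exists_traceGam_eq (γ t)
  have hn : (n : ℝ) + 1 ≠ 0 := by positivity
  have hl : D'.logDerivAlong γ ρ t = D.logDerivAlong γ ρ t - 2 * υ (velocity γ t) := by
    have h0 : coeffAlong γ ρ t t ≠ 0 := by
      rw [coeffAlong_self]
      exact hρ0.ne'
    rw [AffineConnection.logDerivAlong, AffineConnection.logDerivAlong, ht]
    field_simp
    ring
  have hv : D'.vectorDerivAlong γ (velocity γ) t = D.vectorDerivAlong γ (velocity γ) t
      + (2 * υ (velocity γ t)) • velocity γ t := by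
    rw [AffineConnection.vectorDerivAlong, AffineConnection.vectorDerivAlong, hg]
    module
  rw [AffineConnection.weightedAccel, AffineConnection.weightedAccel, hl, hv]
  module

end ProjEquiv

/-- Evaluation on `(1, 0)` and `(0, l)` with `l(γ') = 1` identifies the density required by the
orientation as `k ρ`, so its positivity is that of `k`. -/
lemma AffineConnection.isOriented_smul_curveTractor_iff (D : AffineConnection n M)
    (hγ : IsRegularCurve (n := n) γ J)
    {ρ : (s : ℝ) → Density (-2) n (TangentSpace (𝓡 n) (γ s))}
    (hρ0 : ∀ s ∈ J, 0 < (ρ s).1 (coordFrame (γ s))) (k : ℝ → ℝ) :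
    D.IsOriented γ J (fun s => k s • D.curveTractor γ ρ s) ↔ ∀ t ∈ J, 0 < k t := by
  refine forall₂_congr fun t ht => ⟨?_, fun hk => ⟨k t • ρ t, ?_, fun α β => ?_⟩⟩
  · rintro ⟨σ, hσ, h⟩
    obtain ⟨l, hl⟩ := exists_dual_velocity_eq_one (hγ.velocity_ne_zero t ht)
    obtain ⟨a, ha, ha'⟩ := D.exists_cotractor_val (γ t) 1 0
    obtain ⟨b, hb, hb'⟩ := D.exists_cotractor_val (γ t) 0 (l ∘ₗ chartCoord (γ t) (γ t))
    have h1 := h a b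
    change _ = _ * (xval (γ t) a * D.mval (γ t) (velocity γ t) b
      - xval (γ t) b * D.mval (γ t) (velocity γ t) a) at h1
    rw [AlternatingMap.smul_apply, D.curveTractor_apply, ha, hb, hb', LinearMap.comp_apply, hl,
      smul_eq_mul, zero_mul, sub_zero, one_mul, mul_one, mul_one] at h1
    exact pos_of_mul_pos_left (h1 ▸ hσ) (hρ0 t ht).le
  · rw [Density.smul_apply]
    exact mul_pos hk (hρ0 t ht)
  · rw [AlternatingMap.smul_apply, D.curveTractor_apply, Density.smul_apply, smul_eq_mul, mul_assoc]
    rfl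

end ProjectiveTractor

end

/-! ### The theorem. -/

open ProjectiveTractor in
theorem theorem1p1 {n : ℕ} (hn : 2 ≤ n) {M : Type*} [TopologicalSpace M] [T2Space M]
    [ChartedSpace (EuclideanSpace ℝ (Fin n)) M] [IsManifold (𝓡 n) ∞ M]
    (p : ProjectiveStructure n M) {γ : ℝ → M} {J : Set ℝ} (hγ : IsRegularCurve (n := n) γ J) :
    (∀ D : AffineConnection n M, D.toProjective = p →
      (p.IsUnparamGeodesic γ J ↔ D.IsUnparamGeodesic γ J) ∧
      (p.IsUnparamGeodesic γ J ↔
        ∃ S : (t : ℝ) → TwoTractor n (γ t), D.IsGeodesicTractor γ J S)) ∧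
    (p.IsUnparamGeodesic γ J →
      ∃ S₀ : (t : ℝ) → TwoTractor n (γ t),
        ∀ D : AffineConnection n M, D.toProjective = p →
          ∀ S : (t : ℝ) → TwoTractor n (γ t),
            ((D.IsGeodesicTractor γ J S ∧ D.IsOriented γ J S) ↔
              ∃ c : ℝ, 0 < c ∧ ∀ t ∈ J, S t = c • S₀ t) ∧
            (D.IsGeodesicTractor γ J S ↔
              ∃ c : ℝ, c ≠ 0 ∧ ∀ t ∈ J, S t = c • S₀ t)) := by
  have hJ := hγ.isOpen
  obtain ⟨ρ, hρ, hρ0⟩ := exists_pos_density (-2) hJ hγ.smooth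
  have hequiv : ∀ D D' : AffineConnection n M, D.toProjective = p → D'.toProjective = p →
      ProjEquiv D D' := fun D D' hD hD' => Quotient.exact (hD.trans hD'.symm)
  have hgeo : ∀ D : AffineConnection n M, D.toProjective = p →
      (p.IsUnparamGeodesic γ J ↔ D.IsUnparamGeodesic γ J) := by
    refine fun D hD => ⟨?_, fun h => ⟨D, hD, h⟩⟩
    rintro ⟨D', hD', h⟩
    -- With the same `ρ` the equation for `k` is the same for all connections in the class, so a
    -- positive solution for `D'` is one for `D`.
    obtain ⟨k, hk, hpos, hE⟩ := (D'.isUnparamGeodesic_iff hγ hρ hρ0).1 h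
    refine (D.isUnparamGeodesic_iff hγ hρ hρ0).2 ⟨k, hk, hpos, fun t ht => ?_⟩
    rw [(hequiv D' D hD' hD).weightedAccel_eq (hρ0 t ht)]
    exact hE t ht
  obtain ⟨t₁, ht₁⟩ := hγ.nonempty
  refine ⟨fun D hD => ⟨hgeo D hD, (hgeo D hD).trans ⟨fun h => ?_, ?_⟩⟩, ?_⟩
  · obtain ⟨k, hk, hpos, hE⟩ := (D.isUnparamGeodesic_iff hγ hρ hρ0).1 h
    exact ⟨fun s => k s • D.curveTractor γ ρ s, (D.isGeodesicTractor_iff hγ hρ hρ0 _).2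
      ⟨k, hk, ⟨t₁, ht₁, (hpos t₁ ht₁).ne'⟩, fun _ _ => rfl, hE⟩⟩
  · rintro ⟨S, hS⟩
    obtain ⟨k, hk, hk0, -, hE⟩ := (D.isGeodesicTractor_iff hγ hρ hρ0 S).1 hS
    refine (D.isUnparamGeodesic_iff hγ hρ hρ0).2 ?_
    rcases D.pos_or_neg_of_transport hγ hρ hρ0 hk hE hk0 with h | h
    · exact ⟨k, hk, h, hE⟩
    -- The equation is linear, so a negative solution is replaced by its opposite; this is the case
    -- of a tractor with the reversed orientation.
    · refine ⟨fun s => -k s, hk.neg, fun t ht => neg_pos.2 (h t ht), fun t ht => ?_⟩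
      rw [deriv.fun_neg, neg_smul, neg_smul, ← neg_add, hE t ht, neg_zero]
  · rintro ⟨D₀, hD₀, h₀⟩
    obtain ⟨k₀, hk₀, hpos, hE₀⟩ := (D₀.isUnparamGeodesic_iff hγ hρ hρ0).1 h₀
    -- The tractor built from `D₀` serves every `D` in the class, because both `curveTractor` and
    -- the equation for `k₀` are projectively invariant.
    refine ⟨fun s => k₀ s • D₀.curveTractor γ ρ s, fun D hD S => ?_⟩
    have hDE := hequiv D₀ D hD₀ hD
    have hE : ∀ t ∈ J, deriv k₀ t • velocity γ t + k₀ t • D.weightedAccel γ ρ t = 0 := by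
      intro t ht
      rw [hDE.weightedAccel_eq (hρ0 t ht)]
      exact hE₀ t ht
    have hiff : D.IsGeodesicTractor γ J S ↔
        ∃ c : ℝ, c ≠ 0 ∧ ∀ t ∈ J, S t = c • (k₀ t • D₀.curveTractor γ ρ t) := by
      rw [D.isGeodesicTractor_iff hγ hρ hρ0 S]
      constructor
      · rintro ⟨k, hk, ⟨t, ht, hkt⟩, hS, hEk⟩
        obtain ⟨c, hc⟩ := D.exists_eq_mul_of_transport hγ hk hk₀ hpos hEk hE
        refine ⟨c, ?_, fun t ht => ?_⟩
        · rintro rfl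
          exact hkt (by rw [hc t ht, zero_mul])
        · rw [hS t ht, hc t ht, mul_smul, hDE.curveTractor_eq]
      · rintro ⟨c, hc, hS⟩
        refine ⟨fun s => c * k₀ s, contDiffOn_const.mul hk₀,
          ⟨t₁, ht₁, mul_ne_zero hc (hpos t₁ ht₁).ne'⟩, fun t ht => ?_, fun t ht => ?_⟩
        · rw [hS t ht, mul_smul, hDE.curveTractor_eq]
        · rw [deriv_const_mul_field, mul_smul, mul_smul, ← smul_add, hE t ht, smul_zero]
    refine ⟨?_, hiff⟩
    -- As `k₀` is positive on `J`, the sign of `c k₀` is that of `c`, so the orientation condition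
    -- selects the positive multiples.
    have hor : ∀ c : ℝ, (∀ t ∈ J, S t = c • (k₀ t • D₀.curveTractor γ ρ t)) →
        (D.IsOriented γ J S ↔ 0 < c) := by
      intro c hS
      have h1 : D.IsOriented γ J S ↔
          D.IsOriented γ J (fun s => (c * k₀ s) • D.curveTractor γ ρ s) := by
        refine forall₂_congr fun t ht => ?_
        rw [hS t ht, ← hDE.curveTractor_eq, smul_smul]
      rw [h1, D.isOriented_smul_curveTractor_iff hγ hρ0]
      exact ⟨fun h => pos_of_mul_pos_left (h t₁ ht₁) (hpos t₁ ht₁).le,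
        fun h t ht => mul_pos h (hpos t ht)⟩
    rw [hiff]
    constructor
    · rintro ⟨⟨c, -, hS⟩, hO⟩
      exact ⟨c, (hor c hS).1 hO, hS⟩
    · rintro ⟨c, hc, hS⟩
      exact ⟨⟨c, hc.ne', hS⟩, (hor c hS).2 hc⟩
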